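/- A *spacetime* is a four-dimensional, Hausdorff, second countable, arcwise connected smooth manifold $M$ with a smooth Lorentzian metric $g$ of signature $(-,+,+,+)$; here all spacetimes are oriented. The Hodge dual $*$ is determined by $\omega\wedge *\eta=g^{-1}(\omega,\eta)\,\mu_g$, where $\mu_g$ is the metric volume form; the codifferential is $\delta = *\,d\,*$; and the Laplace–de Rham operator is $\square = d\circ\delta+\delta\circ d$. Let $(M,g)$ and $(\widetilde M,\tilde g)$ be two oriented spacetimes, with operators $\delta,\square$ and $\tilde\delta,\tilde\square$ respectively. Let $\psi:M\to\widetilde M$ be a conformal isometry, i.e. a smooth diffeomorphism (not assumed to preserve the orientations) with $\psi^*\tilde g=\Xi^2 g$ for a strictly positive function $\Xi\in C^\infty(M)$. For $w\in\mathbb R$ let $\psi^*_{(w)}=\Xi^{-w}\psi^*$ be the conformally weighted pull-back of weight $w$. Let $\tilde\phi\in\Omega^1(\widetilde M)$ be a smooth real-valued $1$-form, and put $\phi=\psi^*\tilde\phi$ and $\Upsilon=\Xi^{-1}d\Xi$. Then \begin{align*} \psi^*\tilde\delta\tilde\phi &= \Xi^{-2}\big(\delta\phi-2\,g^{-1}(\Upsilon,\phi)\big),\\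 \psi^*\tilde\delta d\tilde\phi &= \Xi^{-2}\,\delta d\phi,\\ \psi^*\tilde\square\tilde\phi &= \Xi^{-2}\big(\square\phi-2\,d\,g^{-1}(\Upsilon,\phi)+2\,(2\,g^{-1}(\Upsilon,\phi)-\delta\phi)\,\Upsilon\big). \end{align*} In particular $\delta d$ is conformally invariant on $1$-forms of weight $0$: $\psi^*_{(-2)}\tilde\delta d\tilde\phi=\delta d\,\psi^*_{(0)}\tilde\phi$, and $\tilde\delta d\tilde\phi=0$ if and only if $\delta d\phi=0$. Moreover the codifferential intertwines the pull-backs of weight $-2$ and $-4$: $$\psi^*_{(-4)}\tilde\delta\tilde\phi=\delta\,\psi^*_{(-2)}\tilde\phi .$$ -/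

import Mathlib

open scoped Manifold ContDiff
open Module

noncomputable section

namespace ConformalForms

/-! ### Linear algebra on one tangent space -/

section Pointwise

variable {V : Type*} [AddCommGroup V] [Module ℝ V]

/-- A bilinear form on a four-dimensional space has Lorentzian signature `(-,+,+,+)`. -/
def IsLorentzian (B : LinearMap.BilinForm ℝ V) : Prop :=
  ∃ b : Basis (Fin 4) ℝ V, ∀ i j, B (b i) (b j) = if i = j then (if i = 0 then -1 else 1) else 0

theorem IsLorentzian.nondegenerate {B : LinearMap.BilinForm ℝ V} (h : IsLorentzian B) :
    B.Nondegenerate := by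
  obtain ⟨b, hb⟩ := h
  rw [LinearMap.BilinForm.nondegenerate_iff_det_ne_zero b]
  have : LinearMap.BilinForm.toMatrix b B =
      Matrix.diagonal (fun i : Fin 4 => if i = 0 then (-1 : ℝ) else 1) := by
    ext i j
    simp only [LinearMap.BilinForm.toMatrix_apply, hb, Matrix.diagonal_apply]
  rw [this, Matrix.det_diagonal, Finset.prod_ne_zero_iff]
  intro i _
  split_ifs <;> norm_num

variable [TopologicalSpace V]

/-- Insertion of the vectors `u` into the first `p` slots of an alternating `n`-linear form,
`(v₁, …, v_q) ↦ μ (u₁, …, u_p, v₁, …, v_q)`, where `p + q = n`. -/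
def insertLeft {p q n : ℕ} (h : p + q = n) (μ : V [⋀^Fin n]→L[ℝ] ℝ) (u : Fin p → V) :
    V [⋀^Fin q]→L[ℝ] ℝ where
  toFun v := μ (fun i => Fin.append u v (Fin.cast h.symm i))
  map_update_add' := by
    intro _ v i x y
    subst h
    have key : ∀ z : V, Fin.append u (Function.update v i z) =
        Function.update (Fin.append u v) (Fin.natAdd p i) z := by
      intro z
      ext j
      refine Fin.addCases (fun k => ?_) (fun k => ?_) j
      · have hk : Fin.castAdd q k ≠ Fin.natAdd p i := by
          intro hh
          have := congrArg Fin.val hh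
          simp at this
          omega
        simp [Function.update_of_ne hk]
      · by_cases hk : k = i
        · subst hk; simp
        · have hk' : Fin.natAdd p k ≠ Fin.natAdd p i := by simpa using hk
          simp [Function.update_of_ne hk, Function.update_of_ne hk']
    have hd : ‹DecidableEq (Fin q)› = instDecidableEqFin q := Subsingleton.elim _ _
    subst hd
    simp [key]
  map_update_smul' := by
    intro _ v i c x
    subst h
    have key : ∀ z : V, Fin.append u (Function.update v i z) =
        Function.update (Fin.append u v) (Fin.natAdd p i) z := by
      intro z
      ext j
      refine Fin.addCases (fun k => ?_) (fun k => ?_) j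
      · have hk : Fin.castAdd q k ≠ Fin.natAdd p i := by
          intro hh
          have := congrArg Fin.val hh
          simp at this
          omega
        simp [Function.update_of_ne hk]
      · by_cases hk : k = i
        · subst hk; simp
        · have hk' : Fin.natAdd p k ≠ Fin.natAdd p i := by simpa using hk
          simp [Function.update_of_ne hk, Function.update_of_ne hk']
    have hd : ‹DecidableEq (Fin q)› = instDecidableEqFin q := Subsingleton.elim _ _
    subst hd
    simp [key]
  map_eq_zero_of_eq' := by
    intro v i j hv hij
    subst h
    exact μ.map_eq_zero_of_eq _ (i := Fin.natAdd p i) (j := Fin.natAdd p j)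
      (by simpa using hv) (by simpa using hij)
  cont := by
    subst h
    refine μ.cont.comp (continuous_pi fun j => ?_)
    refine Fin.addCases (fun k => ?_) (fun k => ?_) j
    · simpa using continuous_const
    · simpa using continuous_apply k

variable [IsTopologicalAddGroup V] [ContinuousSMul ℝ V] [T2Space V]

/-- The determinant with respect to a basis, as a continuous alternating form. -/
def basisDet (b : Basis (Fin 4) ℝ V) : V [⋀^Fin 4]→L[ℝ] ℝ :=
  { b.det with
    cont := by
      have : FiniteDimensional ℝ V := b.finiteDimensional_of_finite
      change Continuous fun v : Fin 4 → V => b.det v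
      simp only [Basis.det_apply]
      refine Continuous.matrix_det (continuous_pi fun i => continuous_pi fun j => ?_)
      simp only [Basis.toMatrix_apply]
      exact ((b.coord i).continuous_of_finiteDimensional).comp (continuous_apply j) }

/-- The metric volume form `√|det B(bᵢ, bⱼ)| · b¹ ∧ b² ∧ b³ ∧ b⁴` of `B`, computed in a basis `b`
which is positively oriented with respect to `o`. -/
def volumeCovector (B : LinearMap.BilinForm ℝ V) (b : Basis (Fin 4) ℝ V)
    (o : Orientation ℝ V (Fin 4)) : V [⋀^Fin 4]→L[ℝ] ℝ :=
  Real.sqrt |(LinearMap.BilinForm.toMatrix (b.adjustToOrientation o) B).det| •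
    basisDet (b.adjustToOrientation o)

/-- The Hodge dual of a `p`-covector with respect to a metric `B` and a volume form `μ`,
`(*η)_{c₁…c_q} = (1/p!) η^{a₁…a_p} μ_{a₁…a_p c₁…c_q}`,
which is characterised by `ω ∧ *η = B⁻¹(ω, η) μ` when `μ` is a metric volume form.
The vectors `B.dualBasis hB b a` are the metric duals of the covectors `b^a` dual to the basis `b`,
so that evaluating `η` on them raises its indices. -/
def hodgeCovector {p q : ℕ} (h : p + q = 4) (B : LinearMap.BilinForm ℝ V) (hB : B.Nondegenerate)
    (b : Basis (Fin 4) ℝ V) (μ : V [⋀^Fin 4]→L[ℝ] ℝ) (η : V [⋀^Fin p]→L[ℝ] ℝ) :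
    V [⋀^Fin q]→L[ℝ] ℝ :=
  (p.factorial : ℝ)⁻¹ • ∑ a : Fin p → Fin 4,
    η (fun i => B.dualBasis hB b (a i)) • insertLeft h μ (fun i => b (a i))

end Pointwise

/-! ### Lorentzian four-manifolds -/

variable {M : Type*} [TopologicalSpace M] [ChartedSpace (EuclideanSpace ℝ (Fin 4)) M]
variable {N : Type*} [TopologicalSpace N] [ChartedSpace (EuclideanSpace ℝ (Fin 4)) N]

instance (x : M) : T2Space (TangentSpace (𝓡 4) x) :=
  inferInstanceAs (T2Space (EuclideanSpace ℝ (Fin 4)))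

instance (x : M) : FiniteDimensional ℝ (TangentSpace (𝓡 4) x) :=
  inferInstanceAs (FiniteDimensional ℝ (EuclideanSpace ℝ (Fin 4)))

/-- The coordinate basis of `T_x M` in the preferred chart at `x`. -/
def coordBasis (x : M) : Basis (Fin 4) ℝ (TangentSpace (𝓡 4) x) :=
  (EuclideanSpace.basisFun (Fin 4) ℝ).toBasis

variable (M) in
/-- A smooth Lorentzian metric of signature `(-,+,+,+)`. -/
structure LorentzMetric [IsManifold (𝓡 4) ∞ M] where
  /-- The bilinear form on each tangent space. -/
  val (x : M) : TangentSpace (𝓡 4) x →L[ℝ] TangentSpace (𝓡 4) x →L[ℝ] ℝ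
  symm (x : M) (v w : TangentSpace (𝓡 4) x) : val x v w = val x w v
  lorentzian (x : M) : IsLorentzian (V := TangentSpace (𝓡 4) x)
    (LinearMap.mk₂ ℝ (fun v w => val x v w) (by simp) (by simp) (by simp) (by simp))
  contMDiff : ContMDiff (𝓡 4)
    ((𝓡 4).prod 𝓘(ℝ, EuclideanSpace ℝ (Fin 4) →L[ℝ] EuclideanSpace ℝ (Fin 4) →L[ℝ] ℝ)) ∞
    (fun x ↦ Bundle.TotalSpace.mk'
      (EuclideanSpace ℝ (Fin 4) →L[ℝ] EuclideanSpace ℝ (Fin 4) →L[ℝ] ℝ) x (val x))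

variable (M) in
/-- An orientation of a smooth four-manifold: an orientation of every tangent space such that
every point has a neighbourhood with a smooth positively oriented frame. -/
structure ManifoldOrientation [IsManifold (𝓡 4) ∞ M] where
  /-- The orientation of each tangent space. -/
  val (x : M) : Orientation ℝ (TangentSpace (𝓡 4) x) (Fin 4)
  exists_frame (x : M) : ∃ U ∈ nhds x, ∃ s : Fin 4 → (y : M) → TangentSpace (𝓡 4) y,
    ∃ hs : IsLocalFrameOn (𝓡 4) (EuclideanSpace ℝ (Fin 4)) ∞ s U,
      ∀ y (hy : y ∈ U), (hs.toBasisAt hy).orientation = val y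

/-! ### Differential forms -/

variable (M) in
/-- A (not necessarily smooth) real-valued differential `p`-form on `M`. -/
abbrev DForm (p : ℕ) : Type _ := (x : M) → TangentSpace (𝓡 4) x [⋀^Fin p]→L[ℝ] ℝ

/-- The `0`-form given by a function. -/
def ofFun (f : M → ℝ) : DForm M 0 := fun x =>
  ContinuousAlternatingMap.constOfIsEmpty ℝ (TangentSpace (𝓡 4) x) (Fin 0) (f x)

/-- The function given by a `0`-form. -/
def toFun (f : DForm M 0) : M → ℝ := fun x => f x (fun i => i.elim0)

/-- The pull-back `ψ^* η` of a form along a map. -/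
def pullback {p : ℕ} (ψ : M → N) (η : DForm N p) : DForm M p := fun x =>
  (η (ψ x)).compContinuousLinearMap (mfderiv (𝓡 4) (𝓡 4) ψ x)

/-- The local representative of `η` in the chart at `x₀`: the pull-back of `η` along the inverse
of the chart. It is meaningful on the target of the chart. -/
def inChart {p : ℕ} (η : DForm M p) (x₀ : M) :
    EuclideanSpace ℝ (Fin 4) → EuclideanSpace ℝ (Fin 4) [⋀^Fin p]→L[ℝ] ℝ := fun y =>
  (η ((extChartAt (𝓡 4) x₀).symm y)).compContinuousLinearMap
    (mfderiv 𝓘(ℝ, EuclideanSpace ℝ (Fin 4)) (𝓡 4) (extChartAt (𝓡 4) x₀).symm y)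

/-- `η` is a smooth form, that is, an element of `Ω^p(M)`. -/
def IsSmoothForm {p : ℕ} (η : DForm M p) : Prop :=
  ∀ x₀ : M, ContDiffOn ℝ ∞ (inChart η x₀) (extChartAt (𝓡 4) x₀).target

/-- The exterior derivative, computed at `x` in the chart at `x`. -/
def extD {p : ℕ} (η : DForm M p) : DForm M (p + 1) := fun x =>
  (extDeriv (inChart η x) (extChartAt (𝓡 4) x x)).compContinuousLinearMap
    (mfderiv (𝓡 4) 𝓘(ℝ, EuclideanSpace ℝ (Fin 4)) (extChartAt (𝓡 4) x) x)

/-! ### Operators built from the metric -/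

variable [IsManifold (𝓡 4) ∞ M] [IsManifold (𝓡 4) ∞ N]

namespace LorentzMetric

/-- The metric at a point as a bilinear form. -/
def bilin (g : LorentzMetric M) (x : M) : LinearMap.BilinForm ℝ (TangentSpace (𝓡 4) x) :=
  LinearMap.mk₂ ℝ (fun v w => g.val x v w) (by simp) (by simp) (by simp) (by simp)

theorem nondegenerate (g : LorentzMetric M) (x : M) : (g.bilin x).Nondegenerate :=
  (g.lorentzian x).nondegenerate

/-- The vector `α^♯` with `g(α^♯, v) = α(v)` for all `v`. -/
def sharp (g : LorentzMetric M) (x : M) (α : TangentSpace (𝓡 4) x [⋀^Fin 1]→L[ℝ] ℝ) :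
    TangentSpace (𝓡 4) x :=
  ((g.bilin x).toDual (g.nondegenerate x)).symm
    ((ContinuousAlternatingMap.ofSubsingleton ℝ (TangentSpace (𝓡 4) x) ℝ (0 : Fin 1)).symm
      α).toLinearMap

/-- The metric pairing `g⁻¹(α, β)` of `1`-forms. -/
def pairing (g : LorentzMetric M) (α β : DForm M 1) : M → ℝ := fun x =>
  α x (fun _ => g.sharp x (β x))

/-- The volume form `μ_g`. -/
def volumeForm (g : LorentzMetric M) (o : ManifoldOrientation M) : DForm M 4 := fun x =>
  volumeCovector (g.bilin x) (coordBasis x) (o.val x)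

/-- The Hodge dual of `p`-forms. -/
def hodge (g : LorentzMetric M) (o : ManifoldOrientation M) {p q : ℕ} (h : p + q = 4)
    (η : DForm M p) : DForm M q := fun x =>
  hodgeCovector h (g.bilin x) (g.nondegenerate x) (coordBasis x) (g.volumeForm o x) (η x)

/-- The codifferential `δ = * d *` from `(p + 1)`-forms to `p`-forms, where `p + 1 + q = 4`. -/
def codiff (g : LorentzMetric M) (o : ManifoldOrientation M) {p q : ℕ} (h : p + 1 + q = 4)
    (η : DForm M (p + 1)) : DForm M p :=
  g.hodge o (p := q + 1) (q := p) (by omega) (extD (g.hodge o h η))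

/-- The codifferential of `1`-forms. -/
def codiff₁ (g : LorentzMetric M) (o : ManifoldOrientation M) (η : DForm M 1) : DForm M 0 :=
  g.codiff o (p := 0) (q := 3) (by norm_num) η

/-- The codifferential of `2`-forms. -/
def codiff₂ (g : LorentzMetric M) (o : ManifoldOrientation M) (η : DForm M 2) : DForm M 1 :=
  g.codiff o (p := 1) (q := 2) (by norm_num) η

/-- The Laplace–de Rham operator `□ = d δ + δ d` on `1`-forms. -/
def box (g : LorentzMetric M) (o : ManifoldOrientation M) (η : DForm M 1) : DForm M 1 :=
  extD (g.codiff₁ o η) + g.codiff₂ o (extD η)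

end LorentzMetric

/-! ### Conformal isometries -/

/-- The diffeomorphism `ψ` is a conformal isometry with conformal factor `Ξ`: the function `Ξ` is
smooth and strictly positive, and `ψ^* g' = Ξ² g`. -/
structure IsConformalIsometry (g : LorentzMetric M) (g' : LorentzMetric N)
    (ψ : M ≃ₘ^∞⟮𝓡 4, 𝓡 4⟯ N) (Ξ : M → ℝ) : Prop where
  smooth : ContMDiff (𝓡 4) 𝓘(ℝ, ℝ) ∞ Ξ
  pos : ∀ x, 0 < Ξ x
  pullback_eq : ∀ (x : M) (v w : TangentSpace (𝓡 4) x),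
    g'.val (ψ x) (mfderiv (𝓡 4) (𝓡 4) ψ x v) (mfderiv (𝓡 4) (𝓡 4) ψ x w) =
      Ξ x ^ 2 * g.val x v w

/-- The conformally weighted pull-back `ψ^*_{(w)} = Ξ^{-w} ψ^*`. -/
def weightedPullback {p : ℕ} (ψ : M → N) (Ξ : M → ℝ) (w : ℝ) (η : DForm N p) : DForm M p :=
  fun x => (Ξ x ^ (-w)) • pullback ψ η x

/-- The `1`-form `Υ = Ξ⁻¹ dΞ`. -/
def dlogForm (Ξ : M → ℝ) : DForm M 1 := fun x => (Ξ x)⁻¹ • extD (ofFun Ξ) x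

end ConformalForms

end

open ConformalForms

/-! Everything follows from how the Hodge dual scales. At each point the differential of `ψ` is a
linear map multiplying the metric by Ξ². Each of the p indices raised in forming the dual of a
p-form costs a factor Ξ⁻², and the volume form contributes ±Ξ⁴, so ψ^* *̃ = c Ξ^(4-2p) * ψ^* with a
sign c (`hodgeCovector_comp`, `pullback_hodge`). A continuity argument makes c locally constant,
hence constant on a connected manifold (`exists_pullback_volumeForm_eq`). It therefore commutes with
d, and as it enters δ = *d* twice it disappears through c² = 1; this is why `ψ` need not respect the
orientations. Together with naturality of d (`extD_pullback`) this gives, on k-forms, ψ^* δ̃ =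
Ξ^(2k-6) δ Ξ^(4-2k) ψ^* (`pullback_codiff`).

For k = 1 this reads Ξ⁻⁴ δ(Ξ² φ), the intertwining of weights -2 and -4; for k = 2 the inner factor
is 1, which is the invariance of δd. The first formula results from expanding δ(Ξ² φ) by the product
rule δ(fη) = f δη - g⁻¹(df, η) (`codiff₁_smul`), which rests on df ∧ *η = g⁻¹(df, η) μ and on *μ =
-1 in Lorentzian signature. The formula for □ follows by applying d to the first one, where d(Ξ⁻²) =
-2 Ξ⁻² Υ, and adding the second.

The remaining work is regularity. The exterior derivative is computed at each point in that point's
own chart, so naturality requires independence of the chart (`inChart_extD`), and the product rules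
require the Hodge dual of a smooth form to be smooth (`IsSmoothForm.hodge`). -/

noncomputable section

namespace ConformalForms

/-! ### Linear algebra of the Hodge dual on one tangent space -/

section LinearAlgebra

variable {V W : Type*} [AddCommGroup V] [Module ℝ V] [AddCommGroup W] [Module ℝ W]

/-- The coefficients are those expressing `b` through `b'`, so dual vectors transform
contragrediently. This is what makes the sum of dual(a) ⊗ b(a) independent of the basis. -/
theorem dualBasis_eq_sum {B : LinearMap.BilinForm ℝ V} (hB : B.Nondegenerate)
    (b b' : Basis (Fin 4) ℝ V) (c : Fin 4) :
    B.dualBasis hB b' c = ∑ a, b'.repr (b a) c • B.dualBasis hB b a := by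
  conv_lhs => rw [← (B.dualBasis hB b).sum_repr (B.dualBasis hB b' c)]
  refine Finset.sum_congr rfl fun a _ => ?_
  congr 1
  rw [LinearMap.BilinForm.dualBasis_repr_apply]
  conv_lhs => rw [← b'.sum_repr (b a)]
  simp only [map_sum, map_smul, smul_eq_mul, LinearMap.BilinForm.apply_dualBasis_left, mul_ite,
    mul_one, mul_zero, Finset.sum_ite_eq', Finset.mem_univ, if_true]

/-- The full contraction of two multilinear maps by a metric does not depend on the basis. -/
theorem sum_dualBasis_smul_eq {ι N : Type*} [Fintype ι] [DecidableEq ι] [AddCommGroup N] [Module ℝ N]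
    {B : LinearMap.BilinForm ℝ V} (hB : B.Nondegenerate) (b b' : Basis (Fin 4) ℝ V)
    (f : MultilinearMap ℝ (fun _ : ι => V) ℝ) (g : MultilinearMap ℝ (fun _ : ι => V) N) :
    ∑ a : ι → Fin 4, f (fun i => B.dualBasis hB b (a i)) • g (fun i => b (a i)) =
      ∑ a : ι → Fin 4, f (fun i => B.dualBasis hB b' (a i)) • g (fun i => b' (a i)) := by
  have h1 : ∀ a : ι → Fin 4, g (fun i => b (a i)) =
      ∑ c : ι → Fin 4, (∏ i, b'.repr (b (a i)) (c i)) • g (fun i => b' (c i)) := by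
    intro a
    calc g (fun i => b (a i)) = g (fun i => ∑ c, b'.repr (b (a i)) c • b' c) := by
          simp only [Basis.sum_repr]
      _ = _ := by
          rw [g.map_sum]
          exact Finset.sum_congr rfl fun c _ => g.map_smul_univ _ _
  have h2 : ∀ c : ι → Fin 4, f (fun i => B.dualBasis hB b' (c i)) =
      ∑ a : ι → Fin 4, (∏ i, b'.repr (b (a i)) (c i)) • f (fun i => B.dualBasis hB b (a i)) := by
    intro c
    calc f (fun i => B.dualBasis hB b' (c i)) =
          f (fun i => ∑ a, b'.repr (b a) (c i) • B.dualBasis hB b a) := by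
          simp only [← dualBasis_eq_sum hB b b']
      _ = _ := by
          rw [f.map_sum]
          exact Finset.sum_congr rfl fun c _ => f.map_smul_univ _ _
  simp only [h1, h2, Finset.smul_sum, Finset.sum_smul]
  rw [Finset.sum_comm]
  refine Finset.sum_congr rfl fun c _ => Finset.sum_congr rfl fun a _ => ?_
  rw [smul_smul, smul_eq_mul, mul_comm]

/-- The images under `L` of the old dual vectors pair with `b.map L` to `s` instead of 1, hence the
correction `s⁻¹`. This is the source of one factor Ξ⁻² per raised index. -/
theorem dualBasis_map {B : LinearMap.BilinForm ℝ V} {B' : LinearMap.BilinForm ℝ W}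
    (hB : B.Nondegenerate) (hB' : B'.Nondegenerate) (L : V ≃ₗ[ℝ] W) {s : ℝ} (hs : s ≠ 0)
    (hL : ∀ v w, B' (L v) (L w) = s * B v w) (b : Basis (Fin 4) ℝ V) (i : Fin 4) :
    B'.dualBasis hB' (b.map L) i = s⁻¹ • L (B.dualBasis hB b i) := by
  refine (B'.dualBasis hB' (b.map L)).ext_elem fun j => ?_
  rw [LinearMap.BilinForm.dualBasis_repr_apply, LinearMap.BilinForm.dualBasis_repr_apply,
    LinearMap.BilinForm.apply_dualBasis_left, Basis.map_apply, map_smul, LinearMap.smul_apply, hL,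
    LinearMap.BilinForm.apply_dualBasis_left, smul_eq_mul, inv_mul_cancel_left₀ hs]

theorem injective_of_conformal {B : LinearMap.BilinForm ℝ V} {B' : LinearMap.BilinForm ℝ W}
    (hB : B.Nondegenerate) (L : V →ₗ[ℝ] W) {s : ℝ} (hs : s ≠ 0)
    (hL : ∀ v w, B' (L v) (L w) = s * B v w) : Function.Injective L := by
  refine (injective_iff_map_eq_zero L).2 fun v hv => ?_
  refine hB.1 v fun w => ?_
  have := hL v w
  rw [hv, map_zero, LinearMap.zero_apply] at this
  simpa [hs] using this.symm

theorem ext_alternating_of_basis {f g : V [⋀^Fin 4]→ₗ[ℝ] ℝ} (b : Basis (Fin 4) ℝ V)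
    (h : f b = g b) : f = g := by
  rw [f.eq_smul_basis_det b, g.eq_smul_basis_det b, h]

/-- Contraction of the exterior product of a covector with a top form. -/
theorem sum_neg_one_pow_mul_cons_removeNth (μ : V [⋀^Fin 4]→ₗ[ℝ] ℝ) (b : Basis (Fin 4) ℝ V)
    (α : V →ₗ[ℝ] ℝ) (x : V) :
    ∑ i : Fin 4, (-1 : ℝ) ^ (i : ℕ) * (α (b i) * μ (Fin.cons x (i.removeNth b))) =
      α x * μ b := by
  -- Moving `x` from slot 0 to slot `i` costs (-1)^i; once it replaces the `i`-th basis vector, only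
  -- its `i`-th coordinate survives.
  have hx : ∀ i : Fin 4, μ (Fin.cons x (i.removeNth b)) = (-1) ^ (i : ℕ) * (b.repr x i * μ b) := by
    intro i
    have h1 : μ (i.insertNth x (i.removeNth b)) =
        (-1 : ℤˣ) ^ (i : ℕ) • μ (Fin.cons x (i.removeNth b)) :=
      μ.map_insertNth i x (i.removeNth b)
    have h2 : μ (i.insertNth x (i.removeNth b)) = b.repr x i * μ b := by
      rw [Fin.insertNth_removeNth]
      conv_lhs => rw [← b.sum_repr x]
      rw [μ.map_update_sum, Finset.sum_eq_single i]
      · rw [μ.map_update_smul, Function.update_eq_self, smul_eq_mul]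
      · intro j _ hj
        rw [μ.map_update_smul, μ.map_update_self _ hj.symm, smul_zero]
      · simp
    rw [← h2, h1]
    rcases Nat.even_or_odd (i : ℕ) with h | h <;> simp [h.neg_one_pow]
  conv_rhs => rw [← b.sum_repr x, map_sum, Finset.sum_mul]
  refine Finset.sum_congr rfl fun i _ => ?_
  rw [hx, map_smul, smul_eq_mul]
  have : (-1 : ℝ) ^ (i : ℕ) * (-1) ^ (i : ℕ) = 1 := by rw [← mul_pow]; simp
  linear_combination (α (b i) * b.repr x i * μ b) * this

/-- The Gram matrix is PᵀGP, with P the coordinate matrix of `v`. It allows the square of the volume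
form to be written without a basis or an orientation. -/
theorem det_gram (B : LinearMap.BilinForm ℝ V) (b : Basis (Fin 4) ℝ V) (v : Fin 4 → V) :
    (Matrix.of fun i j => B (v i) (v j)).det =
      b.det v ^ 2 * (LinearMap.BilinForm.toMatrix b B).det := by
  have : (Matrix.of fun i j => B (v i) (v j)) =
      (b.toMatrix v).transpose * LinearMap.BilinForm.toMatrix b B * b.toMatrix v := by
    ext i j
    rw [Matrix.of_apply]
    conv_lhs => rw [← b.sum_repr (v i), ← b.sum_repr (v j)]
    simp only [map_sum, map_smul, LinearMap.sum_apply, LinearMap.smul_apply, smul_eq_mul,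
      Matrix.mul_apply, Matrix.transpose_apply, Basis.toMatrix_apply,
      LinearMap.BilinForm.toMatrix_apply, Finset.sum_mul, Finset.mul_sum]
    exact Finset.sum_congr rfl fun _ _ => Finset.sum_congr rfl fun _ _ => by ring
  rw [this, Matrix.det_mul, Matrix.det_mul, Matrix.det_transpose, Basis.det_apply]
  ring

variable [TopologicalSpace V] [TopologicalSpace W]

theorem hodgeCovector_apply {p q : ℕ} (h : p + q = 4) (B : LinearMap.BilinForm ℝ V)
    (hB : B.Nondegenerate) (b : Basis (Fin 4) ℝ V) (μ : V [⋀^Fin 4]→L[ℝ] ℝ)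
    (η : V [⋀^Fin p]→L[ℝ] ℝ) (v : Fin q → V) :
    hodgeCovector h B hB b μ η v = (p.factorial : ℝ)⁻¹ * ∑ a : Fin p → Fin 4,
      η (fun i => B.dualBasis hB b (a i)) *
        μ (fun i => Fin.append (fun i => b (a i)) v (Fin.cast h.symm i)) := by
  simp only [hodgeCovector, ContinuousAlternatingMap.smul_apply, ContinuousAlternatingMap.sum_apply,
    smul_eq_mul]
  rfl

/-- The dual is a full metric contraction in its first p slots. The freedom to change the basis lets
each later computation use an adapted one: a transported basis for naturality, an orthonormal one
for the dual of the volume form. -/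
theorem hodgeCovector_eq_of_basis {p q : ℕ} (h : p + q = 4) {B : LinearMap.BilinForm ℝ V}
    (hB : B.Nondegenerate) (b b' : Basis (Fin 4) ℝ V) (μ : V [⋀^Fin 4]→L[ℝ] ℝ)
    (η : V [⋀^Fin p]→L[ℝ] ℝ) :
    hodgeCovector h B hB b μ η = hodgeCovector h B hB b' μ η := by
  ext v
  rw [hodgeCovector_apply, hodgeCovector_apply]
  -- Currying `μ` into p + q slots makes it a p-linear map with values in q-linear maps, the shape
  -- to which `sum_dualBasis_smul_eq` applies.
  let g : MultilinearMap ℝ (fun _ : Fin p => V)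
      (MultilinearMap ℝ (fun _ : Fin q => V) ℝ) :=
    (μ.toMultilinearMap.domDomCongr (((finCongr h).symm).trans finSumFinEquiv.symm)).currySum
  have hg : ∀ u, g u v = μ (fun i => Fin.append u v (Fin.cast h.symm i)) := by
    intro u
    rw [MultilinearMap.currySum_apply]
    refine congrArg μ (funext fun i => ?_)
    change Sum.rec (motive := fun _ => V) u v (finSumFinEquiv.symm (Fin.cast h.symm i)) = _
    generalize Fin.cast h.symm i = j
    refine Fin.addCases (fun k => ?_) (fun k => ?_) j <;> simp
  have key := congrArg (fun m => m v)
    (sum_dualBasis_smul_eq hB b b' η.toMultilinearMap g)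
  simp only [sum_apply, smul_apply, hg] at key
  exact congrArg _ key

/-- Naturality of the Hodge dual under linear conformal isometries. -/
theorem hodgeCovector_comp {p q : ℕ} (h : p + q = 4) {B : LinearMap.BilinForm ℝ V}
    {B' : LinearMap.BilinForm ℝ W} (hB : B.Nondegenerate) (hB' : B'.Nondegenerate)
    (b : Basis (Fin 4) ℝ V) (b' : Basis (Fin 4) ℝ W) (L : V →L[ℝ] W) {s : ℝ} (hs : s ≠ 0)
    (hL : ∀ v w, B' (L v) (L w) = s * B v w) (μ' : W [⋀^Fin 4]→L[ℝ] ℝ)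
    (η' : W [⋀^Fin p]→L[ℝ] ℝ) :
    (hodgeCovector h B' hB' b' μ' η').compContinuousLinearMap L =
      (s⁻¹) ^ p • hodgeCovector h B hB b (μ'.compContinuousLinearMap L)
        (η'.compContinuousLinearMap L) := by
  have : FiniteDimensional ℝ V := b.finiteDimensional_of_finite
  have : FiniteDimensional ℝ W := b'.finiteDimensional_of_finite
  let e : V ≃ₗ[ℝ] W := L.toLinearMap.linearEquivOfInjective
    (injective_of_conformal (B' := B') hB L.toLinearMap hs hL)
    (by rw [finrank_eq_card_basis b, finrank_eq_card_basis b'])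
  have he : ∀ v, e v = L v := fun v => rfl
  -- In the transported basis the two sums correspond term by term.
  rw [hodgeCovector_eq_of_basis h hB' b' (b.map e)]
  ext v
  rw [ContinuousAlternatingMap.compContinuousLinearMap_apply, hodgeCovector_apply,
    ContinuousAlternatingMap.smul_apply, hodgeCovector_apply, smul_eq_mul, mul_left_comm]
  congr 1
  rw [Finset.mul_sum]
  refine Finset.sum_congr rfl fun a _ => ?_
  have h1 : η' (fun i => B'.dualBasis hB' (b.map e) (a i)) =
      s⁻¹ ^ p * η' (fun i => L (B.dualBasis hB b (a i))) := by
    simp only [dualBasis_map hB hB' e hs hL, he]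
    have := η'.toMultilinearMap.map_smul_univ (fun _ => s⁻¹) (fun i => L (B.dualBasis hB b (a i)))
    simpa using this
  have h2 : (fun i => Fin.append (fun i => (b.map e) (a i)) (L ∘ v) (Fin.cast h.symm i)) =
      L ∘ fun i => Fin.append (fun i => b (a i)) v (Fin.cast h.symm i) := by
    funext i
    simp only [Function.comp]
    generalize Fin.cast h.symm i = j
    refine Fin.addCases (fun k => ?_) (fun k => ?_) j <;> simp [he]
  rw [h1, h2, mul_assoc]
  rfl

theorem hodgeCovector_comp_of_isometry {p q : ℕ} (h : p + q = 4) {B : LinearMap.BilinForm ℝ V}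
    {B' : LinearMap.BilinForm ℝ W} (hB : B.Nondegenerate) (hB' : B'.Nondegenerate)
    (b : Basis (Fin 4) ℝ V) (b' : Basis (Fin 4) ℝ W) (L : V →L[ℝ] W)
    (hL : ∀ v w, B' (L v) (L w) = B v w) (μ' : W [⋀^Fin 4]→L[ℝ] ℝ) (η' : W [⋀^Fin p]→L[ℝ] ℝ) :
    (hodgeCovector h B' hB' b' μ' η').compContinuousLinearMap L =
      hodgeCovector h B hB b (μ'.compContinuousLinearMap L) (η'.compContinuousLinearMap L) := by
  rw [hodgeCovector_comp h hB hB' b b' L one_ne_zero (fun v w => (hL v w).trans (one_mul _).symm),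
    inv_one, one_pow, one_smul]

theorem hodgeCovector_smul {p q : ℕ} (h : p + q = 4) (B : LinearMap.BilinForm ℝ V)
    (hB : B.Nondegenerate) (b : Basis (Fin 4) ℝ V) (μ : V [⋀^Fin 4]→L[ℝ] ℝ) (c : ℝ)
    (η : V [⋀^Fin p]→L[ℝ] ℝ) :
    hodgeCovector h B hB b μ (c • η) = c • hodgeCovector h B hB b μ η := by
  ext v
  simp only [hodgeCovector_apply, ContinuousAlternatingMap.smul_apply, smul_eq_mul, Finset.mul_sum]
  exact Finset.sum_congr rfl fun a _ => by ring

theorem hodgeCovector_add {p q : ℕ} (h : p + q = 4) (B : LinearMap.BilinForm ℝ V)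
    (hB : B.Nondegenerate) (b : Basis (Fin 4) ℝ V) (μ : V [⋀^Fin 4]→L[ℝ] ℝ)
    (η θ : V [⋀^Fin p]→L[ℝ] ℝ) :
    hodgeCovector h B hB b μ (η + θ) =
      hodgeCovector h B hB b μ η + hodgeCovector h B hB b μ θ := by
  ext v
  simp only [hodgeCovector_apply, ContinuousAlternatingMap.add_apply, ← mul_add,
    ← Finset.sum_add_distrib, add_mul]

theorem hodgeCovector_smul_volume {p q : ℕ} (h : p + q = 4) (B : LinearMap.BilinForm ℝ V)
    (hB : B.Nondegenerate) (b : Basis (Fin 4) ℝ V) (c : ℝ) (μ : V [⋀^Fin 4]→L[ℝ] ℝ)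
    (η : V [⋀^Fin p]→L[ℝ] ℝ) :
    hodgeCovector h B hB b (c • μ) η = c • hodgeCovector h B hB b μ η := by
  ext v
  simp only [hodgeCovector_apply, ContinuousAlternatingMap.smul_apply, smul_eq_mul, Finset.mul_sum]
  exact Finset.sum_congr rfl fun a _ => by ring

/-- Here `x` is `η` with its index raised, and the sum defining the dual is the expansion of `x` in
`b` inserted into the first slot of `μ`. -/
theorem hodgeCovector_one (h : 1 + 3 = 4) {B : LinearMap.BilinForm ℝ V}
    (hB : B.Nondegenerate) (hs : ∀ v w, B v w = B w v) (b : Basis (Fin 4) ℝ V)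
    (μ : V [⋀^Fin 4]→L[ℝ] ℝ) (η : V [⋀^Fin 1]→L[ℝ] ℝ) (x : V) (hx : ∀ v, B x v = η (fun _ => v))
    (v : Fin 3 → V) :
    hodgeCovector h B hB b μ η v = μ (Fin.cons x v) := by
  have hxs : x = ∑ a, η (fun _ => B.dualBasis hB b a) • b a := by
    refine (B.dualBasis hB (B.dualBasis hB b)).ext_elem fun j => ?_
    rw [LinearMap.BilinForm.dualBasis_repr_apply, LinearMap.BilinForm.dualBasis_repr_apply]
    simp only [map_sum, map_smul, LinearMap.sum_apply, LinearMap.smul_apply, smul_eq_mul, hx]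
    rw [Finset.sum_eq_single j]
    · rw [hs, LinearMap.BilinForm.apply_dualBasis_left, if_pos rfl, mul_one]
    · intro a _ ha
      rw [hs, LinearMap.BilinForm.apply_dualBasis_left, if_neg ha, mul_zero]
    · simp
  have hμ : ∀ y, μ (Fin.cons y v) = μ (Function.update (Fin.cons 0 v : Fin 4 → V) 0 y) := by
    intro y
    congr 1
    exact (Fin.update_cons_zero (α := fun _ => V) 0 v y).symm
  rw [hodgeCovector_apply, hμ]
  conv_rhs => rw [hxs, ← μ.coe_toAlternatingMap, AlternatingMap.map_update_sum]
  rw [Nat.factorial_one, Nat.cast_one, inv_one, one_mul,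
    ← (Equiv.funUnique (Fin 1) (Fin 4)).symm.sum_comp]
  refine Finset.sum_congr rfl fun a _ => ?_
  rw [AlternatingMap.map_update_smul, smul_eq_mul, μ.coe_toAlternatingMap, ← hμ]
  congr 2
  funext i
  refine Fin.cases ?_ (fun k => ?_) i
  · rfl
  · fin_cases k <;> rfl

/-- Terms with a repeated index vanish, and each of the 4! permutations contributes equally because
its sign is squared. -/
theorem sum_sq_apply_basis (μ : V [⋀^Fin 4]→L[ℝ] ℝ) (b : Basis (Fin 4) ℝ V) (ε : Fin 4 → ℝ) :
    ∑ a : Fin 4 → Fin 4, (∏ i, ε (a i)) * μ (fun i => b (a i)) ^ 2 =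
      24 * ((∏ i, ε i) * μ b ^ 2) := by
  have hinj : ∀ a : Fin 4 → Fin 4, ¬ Function.Injective a →
      (∏ i, ε (a i)) * μ (fun i => b (a i)) ^ 2 = 0 := by
    intro a ha
    have : μ (fun i => b (a i)) = 0 := by
      simp only [Function.Injective, not_forall] at ha
      obtain ⟨i, j, hij, hne⟩ := ha
      exact μ.map_eq_zero_of_eq _ (by rw [hij]) hne
    rw [this]; ring
  have hperm : ∑ a : Fin 4 → Fin 4, (∏ i, ε (a i)) * μ (fun i => b (a i)) ^ 2 =
      ∑ σ : Equiv.Perm (Fin 4), (∏ i, ε (σ i)) * μ (fun i => b (σ i)) ^ 2 := by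
    symm
    refine Finset.sum_of_injOn (fun σ => ⇑σ) (fun _ _ _ _ hst => DFunLike.coe_injective hst)
      (fun _ _ => Finset.mem_coe.2 (Finset.mem_univ _)) (fun a _ ha => hinj a fun hi => ha ?_)
      (fun _ _ => rfl)
    exact ⟨Equiv.ofBijective a (Finite.injective_iff_bijective.1 hi), by simp, rfl⟩
  have hσ : ∀ σ : Equiv.Perm (Fin 4), (∏ i, ε (σ i)) * μ (fun i => b (σ i)) ^ 2 =
      (∏ i, ε i) * μ b ^ 2 := by
    intro σ
    rw [Equiv.prod_comp]
    have : μ (fun i => b (σ i)) = Equiv.Perm.sign σ • μ b :=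
      μ.toAlternatingMap.map_perm b σ
    rw [this]
    rcases Int.units_eq_one_or (Equiv.Perm.sign σ) with h | h <;> simp [h]
  rw [hperm, Finset.sum_congr rfl fun σ _ => hσ σ, Finset.sum_const, Finset.card_univ,
    Fintype.card_perm, Fintype.card_fin, nsmul_eq_mul]
  norm_num [Nat.factorial]

/-- In an orthonormal basis the 4! equal terms cancel the factorial and leave the product of the
signs (-,+,+,+). The normalisation of `μ` enters only through its square, so the orientation plays
no role. -/
theorem hodgeCovector_volume (h : 4 + 0 = 4) {B : LinearMap.BilinForm ℝ V}
    (hB : B.Nondegenerate) (hl : IsLorentzian B) (b : Basis (Fin 4) ℝ V)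
    (μ : V [⋀^Fin 4]→L[ℝ] ℝ)
    (hμ : ∀ v : Fin 4 → V, μ v ^ 2 = |(Matrix.of fun i j => B (v i) (v j)).det|)
    (v : Fin 0 → V) :
    hodgeCovector h B hB b μ μ v = -1 := by
  obtain ⟨c, hc⟩ := hl
  rw [hodgeCovector_eq_of_basis h hB b c, hodgeCovector_apply]
  set ε : Fin 4 → ℝ := fun i => if i = 0 then -1 else 1 with hε
  have hd : ∀ i, B.dualBasis hB c i = ε i • c i := by
    intro i
    refine (B.dualBasis hB c).ext_elem fun j => ?_
    rw [LinearMap.BilinForm.dualBasis_repr_apply, LinearMap.BilinForm.dualBasis_repr_apply,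
      LinearMap.BilinForm.apply_dualBasis_left, map_smul, LinearMap.smul_apply, hc]
    fin_cases i <;> fin_cases j <;> simp [hε]
  have hc1 : μ c ^ 2 = 1 := by
    have hm : (Matrix.of fun i j => B (c i) (c j)) = Matrix.diagonal ε := by
      ext i j
      rw [Matrix.of_apply, hc, Matrix.diagonal_apply]
    rw [hμ, hm, Matrix.det_diagonal]
    simp [hε]
  have hsum : ∀ a : Fin 4 → Fin 4, μ (fun i => B.dualBasis hB c (a i)) *
      μ (fun i => Fin.append (fun i => c (a i)) v (Fin.cast h.symm i)) =
      (∏ i, ε (a i)) * μ (fun i => c (a i)) ^ 2 := by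
    intro a
    have h1 : μ (fun i => B.dualBasis hB c (a i)) = (∏ i, ε (a i)) * μ (fun i => c (a i)) := by
      simp only [hd]
      exact μ.toMultilinearMap.map_smul_univ (fun i => ε (a i)) (fun i => c (a i))
    have h2 : (fun i => Fin.append (fun i => c (a i)) v (Fin.cast h.symm i)) =
        fun i => c (a i) := by
      funext i
      exact Fin.append_left (fun i => c (a i)) v i
    rw [h1, h2]; ring
  rw [Finset.sum_congr rfl fun a _ => hsum a, sum_sq_apply_basis, hc1]
  simp [hε, Nat.factorial]

/-! ### The metric volume form of one tangent space -/

section Volume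

variable [IsTopologicalAddGroup V] [ContinuousSMul ℝ V] [T2Space V]

theorem volumeCovector_apply (B : LinearMap.BilinForm ℝ V) (b : Basis (Fin 4) ℝ V)
    (o : Orientation ℝ V (Fin 4)) (v : Fin 4 → V) :
    volumeCovector B b o v =
      Real.sqrt |(LinearMap.BilinForm.toMatrix (b.adjustToOrientation o) B).det| *
        (b.adjustToOrientation o).det v := rfl

theorem volumeCovector_sq (B : LinearMap.BilinForm ℝ V) (b : Basis (Fin 4) ℝ V)
    (o : Orientation ℝ V (Fin 4)) (v : Fin 4 → V) :
    volumeCovector B b o v ^ 2 = |(Matrix.of fun i j => B (v i) (v j)).det| := by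
  rw [volumeCovector_apply, det_gram B (b.adjustToOrientation o) v, mul_pow,
    Real.sq_sqrt (abs_nonneg _), abs_mul, abs_of_nonneg (sq_nonneg ((b.adjustToOrientation o).det v)),
    mul_comm]

theorem volumeCovector_pos {B : LinearMap.BilinForm ℝ V} (hB : B.Nondegenerate)
    (b c : Basis (Fin 4) ℝ V) (o : Orientation ℝ V (Fin 4)) (hc : c.orientation = o) :
    0 < volumeCovector B b o c := by
  rw [volumeCovector_apply]
  refine mul_pos (Real.sqrt_pos.2 (abs_pos.2 ?_)) ?_
  · exact (LinearMap.BilinForm.nondegenerate_iff_det_ne_zero _).1 hB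
  · rw [← Basis.orientation_eq_iff_det_pos, Basis.orientation_adjustToOrientation, hc]

end Volume

end LinearAlgebra

open scoped Topology
open Set Filter

local notation "𝔼" => EuclideanSpace ℝ (Fin 4)

/-! ### Smoothness and exterior derivatives of forms on the model space -/

section ModelSpace

/-- The standard basis of the model space. -/
abbrev stdBasis : Basis (Fin 4) ℝ 𝔼 := (EuclideanSpace.basisFun (Fin 4) ℝ).toBasis

/-- The components of an alternating form in the standard basis. -/
def components (p : ℕ) : 𝔼 [⋀^Fin p]→L[ℝ] ℝ →L[ℝ] ((Fin p → Fin 4) → ℝ) :=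
  ContinuousLinearMap.pi fun a =>
    ContinuousAlternatingMap.apply ℝ 𝔼 ℝ (fun i => stdBasis (a i))

theorem components_injective (p : ℕ) : Function.Injective (components p) := by
  intro η θ h
  refine ContinuousAlternatingMap.toAlternatingMap_injective
    (Basis.ext_alternating stdBasis fun v _ => ?_)
  exact congrFun h v

theorem contDiffAt_form_iff {G : Type*} [NormedAddCommGroup G] [NormedSpace ℝ G] {p : ℕ}
    {α : G → 𝔼 [⋀^Fin p]→L[ℝ] ℝ} {y : G} :
    ContDiffAt ℝ ∞ α y ↔
      ∀ a : Fin p → Fin 4, ContDiffAt ℝ ∞ (fun z => α z (fun i => stdBasis (a i))) y := by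
  constructor
  · intro h a
    exact (ContinuousAlternatingMap.apply ℝ 𝔼 ℝ
      (fun i => stdBasis (a i))).contDiff.contDiffAt.comp y h
  · intro h
    -- A linear left inverse of the component map is continuous because its domain is
    -- finite-dimensional; it rebuilds the form smoothly from its components.
    obtain ⟨R, hR⟩ := (components p).toLinearMap.exists_leftInverse_of_injective
      (LinearMap.ker_eq_bot.2 (components_injective p))
    have hα : α = fun z => R.toContinuousLinearMap (components p (α z)) := by
      funext z
      exact (LinearMap.congr_fun hR (α z)).symm
    rw [hα]
    refine R.toContinuousLinearMap.contDiff.contDiffAt.comp y (contDiffAt_pi.2 fun a => h a)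

theorem form_apply_eq_sum {p : ℕ} (η : 𝔼 [⋀^Fin p]→L[ℝ] ℝ) (v : Fin p → 𝔼) :
    η v = ∑ a : Fin p → Fin 4, (∏ i, v i (a i)) * η (fun i => stdBasis (a i)) := by
  calc η v = η.toMultilinearMap (fun i => ∑ c, v i c • stdBasis c) := by
        refine congrArg η (funext fun i => ?_)
        conv_lhs => rw [← stdBasis.sum_repr (v i)]
        simp
    _ = _ := by
        rw [MultilinearMap.map_sum]
        exact Finset.sum_congr rfl fun c _ => MultilinearMap.map_smul_univ _ _ _

theorem contDiffAt_form_apply {G : Type*} [NormedAddCommGroup G] [NormedSpace ℝ G] {p : ℕ}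
    {α : G → 𝔼 [⋀^Fin p]→L[ℝ] ℝ} {v : Fin p → G → 𝔼} {y : G} (hα : ContDiffAt ℝ ∞ α y)
    (hv : ∀ i, ContDiffAt ℝ ∞ (v i) y) :
    ContDiffAt ℝ ∞ (fun z => α z (fun i => v i z)) y := by
  simp only [form_apply_eq_sum _ (fun i => v i _)]
  refine ContDiffAt.sum fun a _ => ContDiffAt.mul (contDiffAt_prod fun i _ => ?_)
    (contDiffAt_form_iff.1 hα a)
  exact (EuclideanSpace.proj (𝕜 := ℝ) (a i)).contDiff.contDiffAt.comp y (hv i)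

theorem contDiffAt_form_pullback {p : ℕ} {α : 𝔼 → 𝔼 [⋀^Fin p]→L[ℝ] ℝ} {T : 𝔼 → 𝔼} {y : 𝔼}
    (hα : ContDiffAt ℝ ∞ α (T y)) (hT : ContDiffAt ℝ ∞ T y) :
    ContDiffAt ℝ ∞ (fun z => (α (T z)).compContinuousLinearMap (fderiv ℝ T z)) y := by
  rw [contDiffAt_form_iff]
  intro a
  have hv : ∀ i, ContDiffAt ℝ ∞ (fun z => fderiv ℝ T z (stdBasis (a i))) y := fun i =>
    (hT.fderiv_right (m := ∞) (by simp)).clm_apply contDiffAt_const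
  exact contDiffAt_form_apply (α := fun z => α (T z)) (hα.comp y hT) hv

theorem contDiffAt_extDeriv {p : ℕ} {α : 𝔼 → 𝔼 [⋀^Fin p]→L[ℝ] ℝ} {y : 𝔼}
    (hα : ContDiffAt ℝ ∞ α y) : ContDiffAt ℝ ∞ (extDeriv α) y :=
  ContDiffAt.comp (g := ContinuousAlternatingMap.alternatizeUncurryFinCLM ℝ 𝔼 ℝ (n := p)) y
    (ContinuousLinearMap.contDiff _).contDiffAt (hα.fderiv_right (m := ∞) (by simp))

/-- The sum on the right is df ∧ α written out on `v`. -/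
theorem extDeriv_fun_smul_apply {p : ℕ} {f : 𝔼 → ℝ} {α : 𝔼 → 𝔼 [⋀^Fin p]→L[ℝ] ℝ} {y : 𝔼}
    (hf : DifferentiableAt ℝ f y) (hα : DifferentiableAt ℝ α y) (v : Fin (p + 1) → 𝔼) :
    extDeriv (fun z => f z • α z) y v = f y * extDeriv α y v +
      ∑ i : Fin (p + 1), (-1 : ℝ) ^ (i : ℕ) * (fderiv ℝ f y (v i) * α y (i.removeNth v)) := by
  have hfα : DifferentiableAt ℝ (fun z => f z • α z) y := hf.smul hα
  rw [extDeriv_apply hfα, extDeriv_apply hα, Finset.mul_sum, ← Finset.sum_add_distrib]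
  refine Finset.sum_congr rfl fun i _ => ?_
  have hαi : DifferentiableAt ℝ (fun z => α z (i.removeNth v)) y :=
    (ContinuousAlternatingMap.apply ℝ 𝔼 ℝ (i.removeNth v)).differentiableAt.comp y hα
  simp only [ContinuousAlternatingMap.smul_apply]
  rw [fderiv_fun_smul hf hαi]
  simp only [add_apply, smul_apply,
    ContinuousLinearMap.smulRight_apply, smul_eq_mul]
  rcases Nat.even_or_odd (i : ℕ) with h | h <;> simp [h.neg_one_pow]

theorem extDeriv_sub_apply {p : ℕ} {α β : 𝔼 → 𝔼 [⋀^Fin p]→L[ℝ] ℝ} {y : 𝔼}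
    (hα : DifferentiableAt ℝ α y) (hβ : DifferentiableAt ℝ β y) :
    extDeriv (fun z => α z - β z) y = extDeriv α y - extDeriv β y := by
  have h : (fun z => α z - β z) = α + (-1 : ℝ) • β := by
    funext z
    ext v
    change α z v - β z v = α z v + (-1 : ℝ) * β z v
    ring
  rw [h, extDeriv_add hα (hβ.const_smul (-1 : ℝ)), extDeriv_smul, neg_one_smul, sub_eq_add_neg]

end ModelSpace

/-! ### Forms in charts: chart independence and naturality of the exterior derivative -/

section Charts

variable {M : Type*} [TopologicalSpace M] [ChartedSpace 𝔼 M]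
variable {N : Type*} [TopologicalSpace N] [ChartedSpace 𝔼 N]

theorem extChartAt_target_mem_nhds_of_mem {x₀ : M} {y : 𝔼} (hy : y ∈ (extChartAt (𝓡 4) x₀).target) :
    (extChartAt (𝓡 4) x₀).target ∈ 𝓝 y :=
  (isOpen_extChartAt_target x₀).mem_nhds hy

theorem IsSmoothForm.contDiffAt {p : ℕ} {η : DForm M p} (hη : IsSmoothForm η) {x₀ : M} {y : 𝔼}
    (hy : y ∈ (extChartAt (𝓡 4) x₀).target) : ContDiffAt ℝ ∞ (inChart η x₀) y :=
  (hη x₀).contDiffAt (extChartAt_target_mem_nhds_of_mem hy)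

theorem isSmoothForm_of_contDiffAt {p : ℕ} {η : DForm M p}
    (h : ∀ x₀ : M, ∀ y ∈ (extChartAt (𝓡 4) x₀).target, ContDiffAt ℝ ∞ (inChart η x₀) y) :
    IsSmoothForm η :=
  fun x₀ y hy => (h x₀ y hy).contDiffWithinAt

theorem inChart_smul {p : ℕ} (f : M → ℝ) (η : DForm M p) (x₀ : M) :
    inChart (fun x => f x • η x) x₀ =
      fun y => f ((extChartAt (𝓡 4) x₀).symm y) • inChart η x₀ y := rfl

theorem inChart_ofFun (f : M → ℝ) (x₀ : M) :
    inChart (ofFun f) x₀ = fun y => ContinuousAlternatingMap.constOfIsEmpty ℝ 𝔼 (Fin 0)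
      (f ((extChartAt (𝓡 4) x₀).symm y)) := rfl

theorem eventually_mem_chart {ψ : M → N} {x₀ : M} {x₁ : N} {y : 𝔼} (hψ : Continuous ψ)
    (hy : y ∈ (extChartAt (𝓡 4) x₀).target)
    (hx : ψ ((extChartAt (𝓡 4) x₀).symm y) ∈ (extChartAt (𝓡 4) x₁).source) :
    ∀ᶠ z in 𝓝 y, z ∈ (extChartAt (𝓡 4) x₀).target ∧
      ψ ((extChartAt (𝓡 4) x₀).symm z) ∈ (extChartAt (𝓡 4) x₁).source := by
  refine (extChartAt_target_mem_nhds_of_mem hy |> Filter.Eventually.and) ?_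
  have hc : ContinuousAt (fun z => ψ ((extChartAt (𝓡 4) x₀).symm z)) y :=
    hψ.continuousAt.comp (continuousAt_extChartAt_symm'' hy)
  exact hc.preimage_mem_nhds ((isOpen_extChartAt_source x₁).mem_nhds hx)

theorem pullback_id {p : ℕ} (η : DForm M p) : ConformalForms.pullback id η = η := by
  funext x
  ext v
  change η x (fun i => mfderiv (𝓡 4) (𝓡 4) id x (v i)) = η x v
  rw [mfderiv_id]
  rfl

theorem isSmoothForm_ofFun_iff {f : M → ℝ} :
    IsSmoothForm (ofFun f) ↔ ∀ x₀ : M, ∀ y ∈ (extChartAt (𝓡 4) x₀).target,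
      ContDiffAt ℝ ∞ (fun z => f ((extChartAt (𝓡 4) x₀).symm z)) y := by
  constructor
  · intro h x₀ y hy
    exact contDiffAt_form_iff.1 (h.contDiffAt hy) (fun i => i.elim0)
  · intro h
    refine isSmoothForm_of_contDiffAt fun x₀ y hy => contDiffAt_form_iff.2 fun a => h x₀ y hy

theorem IsSmoothForm.sub {p : ℕ} {η θ : DForm M p} (hη : IsSmoothForm η)
    (hθ : IsSmoothForm θ) : IsSmoothForm (fun x => η x - θ x) := by
  refine isSmoothForm_of_contDiffAt fun x₀ y hy => ?_
  exact (hη.contDiffAt hy).sub (hθ.contDiffAt hy)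

theorem IsSmoothForm.smul {p : ℕ} {f : M → ℝ} {η : DForm M p} (hf : IsSmoothForm (ofFun f))
    (hη : IsSmoothForm η) : IsSmoothForm (fun x => f x • η x) := by
  refine isSmoothForm_of_contDiffAt fun x₀ y hy => ?_
  rw [inChart_smul]
  exact (isSmoothForm_ofFun_iff.1 hf x₀ y hy).smul (hη.contDiffAt hy)

variable [IsManifold (𝓡 4) ∞ M] [IsManifold (𝓡 4) ∞ N]

theorem contMDiffAt_extChartAt_symm {x₀ : M} {y : 𝔼} (hy : y ∈ (extChartAt (𝓡 4) x₀).target) :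
    ContMDiffAt 𝓘(ℝ, 𝔼) (𝓡 4) ∞ (extChartAt (𝓡 4) x₀).symm y :=
  (contMDiffOn_extChartAt_symm x₀).contMDiffAt (extChartAt_target_mem_nhds_of_mem hy)

/-- A map written in the charts at `x₀` and `x₁`. -/
def chartRep (ψ : M → N) (x₀ : M) (x₁ : N) : 𝔼 → 𝔼 :=
  fun y => extChartAt (𝓡 4) x₁ (ψ ((extChartAt (𝓡 4) x₀).symm y))

variable {ψ : M → N} {x₀ : M} {x₁ : N} {y : 𝔼}

theorem contDiffAt_chartRep (hψ : ContMDiff (𝓡 4) (𝓡 4) ∞ ψ)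
    (hy : y ∈ (extChartAt (𝓡 4) x₀).target)
    (hx : ψ ((extChartAt (𝓡 4) x₀).symm y) ∈ (extChartAt (𝓡 4) x₁).source) :
    ContDiffAt ℝ ∞ (chartRep ψ x₀ x₁) y := by
  rw [← contMDiffAt_iff_contDiffAt]
  refine ContMDiffAt.comp y (contMDiffAt_extChartAt' (by simpa using hx)) ?_
  exact hψ.contMDiffAt.comp y (contMDiffAt_extChartAt_symm hy)

/-- Chain rule for the two factorisations of `ψ` ∘ (chart)⁻¹, which agree near `y`. -/
theorem mfderiv_comp_symm_eq (hψ : ContMDiff (𝓡 4) (𝓡 4) ∞ ψ)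
    (hy : y ∈ (extChartAt (𝓡 4) x₀).target)
    (hx : ψ ((extChartAt (𝓡 4) x₀).symm y) ∈ (extChartAt (𝓡 4) x₁).source) (v : 𝔼) :
    mfderiv (𝓡 4) (𝓡 4) ψ ((extChartAt (𝓡 4) x₀).symm y)
        (mfderiv 𝓘(ℝ, 𝔼) (𝓡 4) (extChartAt (𝓡 4) x₀).symm y v) =
      mfderiv 𝓘(ℝ, 𝔼) (𝓡 4) (extChartAt (𝓡 4) x₁).symm (chartRep ψ x₀ x₁ y)
        (fderiv ℝ (chartRep ψ x₀ x₁) y v) := by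
  have hT := contDiffAt_chartRep hψ hy hx
  have hTy : chartRep ψ x₀ x₁ y ∈ (extChartAt (𝓡 4) x₁).target :=
    (extChartAt (𝓡 4) x₁).map_source hx
  have h1 : HasMFDerivAt 𝓘(ℝ, 𝔼) (𝓡 4) (fun z => ψ ((extChartAt (𝓡 4) x₀).symm z)) y
      ((mfderiv (𝓡 4) (𝓡 4) ψ ((extChartAt (𝓡 4) x₀).symm y)).comp
        (mfderiv 𝓘(ℝ, 𝔼) (𝓡 4) (extChartAt (𝓡 4) x₀).symm y)) :=
    HasMFDerivAt.comp y (hψ.mdifferentiable (by simp) _).hasMFDerivAt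
      ((contMDiffAt_extChartAt_symm hy).mdifferentiableAt (by simp)).hasMFDerivAt
  have h2 : HasMFDerivAt 𝓘(ℝ, 𝔼) (𝓡 4)
      (fun z => (extChartAt (𝓡 4) x₁).symm (chartRep ψ x₀ x₁ z)) y
      ((mfderiv 𝓘(ℝ, 𝔼) (𝓡 4) (extChartAt (𝓡 4) x₁).symm (chartRep ψ x₀ x₁ y)).comp
        (fderiv ℝ (chartRep ψ x₀ x₁) y)) :=
    HasMFDerivAt.comp y
      ((contMDiffAt_extChartAt_symm hTy).mdifferentiableAt (by simp)).hasMFDerivAt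
      (hT.differentiableAt (by simp)).hasFDerivAt.hasMFDerivAt
  have h3 : (fun z => ψ ((extChartAt (𝓡 4) x₀).symm z)) =ᶠ[𝓝 y]
      (fun z => (extChartAt (𝓡 4) x₁).symm (chartRep ψ x₀ x₁ z)) := by
    filter_upwards [eventually_mem_chart hψ.continuous hy hx] with z hz
    exact ((extChartAt (𝓡 4) x₁).left_inv hz.2).symm
  exact DFunLike.congr_fun (hasMFDerivAt_unique h1 (h2.congr_of_eventuallyEq h3)) v

theorem inChart_pullback_apply {p : ℕ} (η : DForm N p) (hψ : ContMDiff (𝓡 4) (𝓡 4) ∞ ψ)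
    (hy : y ∈ (extChartAt (𝓡 4) x₀).target)
    (hx : ψ ((extChartAt (𝓡 4) x₀).symm y) ∈ (extChartAt (𝓡 4) x₁).source) :
    inChart (pullback ψ η) x₀ y =
      (inChart η x₁ (chartRep ψ x₀ x₁ y)).compContinuousLinearMap
        (fderiv ℝ (chartRep ψ x₀ x₁) y) := by
  ext v
  have h : (extChartAt (𝓡 4) x₁).symm (chartRep ψ x₀ x₁ y) =
      ψ ((extChartAt (𝓡 4) x₀).symm y) := (extChartAt (𝓡 4) x₁).left_inv hx
  change η (ψ ((extChartAt (𝓡 4) x₀).symm y)) (fun i => mfderiv (𝓡 4) (𝓡 4) ψ _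
      (mfderiv 𝓘(ℝ, 𝔼) (𝓡 4) (extChartAt (𝓡 4) x₀).symm y (v i))) =
    η ((extChartAt (𝓡 4) x₁).symm (chartRep ψ x₀ x₁ y)) (fun i =>
      mfderiv 𝓘(ℝ, 𝔼) (𝓡 4) (extChartAt (𝓡 4) x₁).symm (chartRep ψ x₀ x₁ y)
        (fderiv ℝ (chartRep ψ x₀ x₁) y (v i)))
  rw [h]
  exact congrArg _ (funext fun i => mfderiv_comp_symm_eq hψ hy hx (v i))

theorem inChart_pullback_eventuallyEq {p : ℕ} (η : DForm N p) (hψ : ContMDiff (𝓡 4) (𝓡 4) ∞ ψ)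
    (hy : y ∈ (extChartAt (𝓡 4) x₀).target)
    (hx : ψ ((extChartAt (𝓡 4) x₀).symm y) ∈ (extChartAt (𝓡 4) x₁).source) :
    inChart (pullback ψ η) x₀ =ᶠ[𝓝 y] fun z =>
      (inChart η x₁ (chartRep ψ x₀ x₁ z)).compContinuousLinearMap
        (fderiv ℝ (chartRep ψ x₀ x₁) z) := by
  filter_upwards [eventually_mem_chart hψ.continuous hy hx] with z hz
  exact inChart_pullback_apply η hψ hz.1 hz.2

theorem IsSmoothForm.pullback {p : ℕ} {η : DForm N p} (hη : IsSmoothForm η)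
    (hψ : ContMDiff (𝓡 4) (𝓡 4) ∞ ψ) : IsSmoothForm (pullback ψ η) := by
  refine isSmoothForm_of_contDiffAt fun x₀ y hy => ?_
  have hx := mem_extChartAt_source (I := 𝓡 4) (ψ ((extChartAt (𝓡 4) x₀).symm y))
  refine ContDiffAt.congr_of_eventuallyEq ?_ (inChart_pullback_eventuallyEq η hψ hy hx)
  exact contDiffAt_form_pullback (hη.contDiffAt ((extChartAt (𝓡 4) _).map_source hx))
    (contDiffAt_chartRep hψ hy hx)

theorem extDeriv_inChart_pullback {p : ℕ} {η : DForm N p} (hη : IsSmoothForm η)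
    (hψ : ContMDiff (𝓡 4) (𝓡 4) ∞ ψ) (hy : y ∈ (extChartAt (𝓡 4) x₀).target)
    (hx : ψ ((extChartAt (𝓡 4) x₀).symm y) ∈ (extChartAt (𝓡 4) x₁).source) :
    extDeriv (inChart (ConformalForms.pullback ψ η) x₀) y =
      (extDeriv (inChart η x₁) (chartRep ψ x₀ x₁ y)).compContinuousLinearMap
        (fderiv ℝ (chartRep ψ x₀ x₁) y) := by
  rw [(inChart_pullback_eventuallyEq η hψ hy hx).extDeriv_eq]
  exact extDeriv_pullback
    ((hη.contDiffAt ((extChartAt (𝓡 4) _).map_source hx)).differentiableAt (by simp))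
    (contDiffAt_chartRep hψ hy hx) (r := ∞) (by
      rw [minSmoothness_of_isRCLikeNormedField]; exact WithTop.coe_le_coe.2 (le_top : (2 : ℕ∞) ≤ ⊤))

/-- The preferred chart at `x` has identity derivative at `x`, since it is the chart that identifies
the tangent space with the model space. -/
theorem extD_apply {p : ℕ} (η : DForm M p) (x : M) :
    extD η x = extDeriv (inChart η x) (extChartAt (𝓡 4) x x) := by
  ext v
  change extDeriv (inChart η x) (extChartAt (𝓡 4) x x) (fun i => mfderiv (𝓡 4) 𝓘(ℝ, 𝔼)
    (extChartAt (𝓡 4) x) x (v i)) = _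
  rw [mfderiv_extChartAt_self]
  rfl

theorem mfderiv_extChartAt_symm_self (x : M) (v : 𝔼) :
    mfderiv 𝓘(ℝ, 𝔼) (𝓡 4) (extChartAt (𝓡 4) x).symm (extChartAt (𝓡 4) x x) v = v := by
  have h := mfderivWithin_range_extChartAt_symm (I := 𝓡 4) (x := x)
  rw [ModelWithCorners.range_eq_univ, mfderivWithin_univ] at h
  rw [h]
  rfl

theorem inChart_self {p : ℕ} (η : DForm M p) (x : M) :
    inChart η x (extChartAt (𝓡 4) x x) = η x := by
  ext v
  change η _ (fun i => mfderiv 𝓘(ℝ, 𝔼) (𝓡 4) (extChartAt (𝓡 4) x).symm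
    (extChartAt (𝓡 4) x x) (v i)) = η x v
  simp only [mfderiv_extChartAt_symm_self]
  rw [extChartAt_to_inv]

/-- Chart independence of d. The chart at `x₀` is compared with the chart at the point under `y` by
viewing the transition map as the local form of `id`, so that naturality of `extDeriv` under
pull-back applies. -/
theorem inChart_extD {p : ℕ} {η : DForm M p} (hη : IsSmoothForm η) {x₀ : M} {y : 𝔼}
    (hy : y ∈ (extChartAt (𝓡 4) x₀).target) :
    inChart (extD η) x₀ y = extDeriv (inChart η x₀) y := by
  set m := (extChartAt (𝓡 4) x₀).symm y with hm
  have hx : id ((extChartAt (𝓡 4) x₀).symm y) ∈ (extChartAt (𝓡 4) m).source :=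
    mem_extChartAt_source m
  have h1 := inChart_pullback_apply (ψ := id) (extD η) contMDiff_id hy hx
  have h2 := extDeriv_inChart_pullback (ψ := id) hη contMDiff_id hy hx
  rw [pullback_id] at h1 h2
  rw [h1, h2]
  have h3 : chartRep id x₀ m y = extChartAt (𝓡 4) m m := rfl
  rw [h3, inChart_self, extD_apply]

theorem IsSmoothForm.extD {p : ℕ} {η : DForm M p} (hη : IsSmoothForm η) :
    IsSmoothForm (extD η) := by
  intro x₀ y hy
  exact ((contDiffAt_extDeriv (hη.contDiffAt hy)).contDiffWithinAt).congr
    (fun z hz => inChart_extD hη hz) (inChart_extD hη hy)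

theorem extD_pullback {p : ℕ} {η : DForm N p} (hη : IsSmoothForm η)
    (hψ : ContMDiff (𝓡 4) (𝓡 4) ∞ ψ) :
    ConformalForms.extD (ConformalForms.pullback ψ η) =
      ConformalForms.pullback ψ (ConformalForms.extD η) := by
  funext x
  have hy : extChartAt (𝓡 4) x x ∈ (extChartAt (𝓡 4) x).target := mem_extChartAt_target x
  have hx : ψ ((extChartAt (𝓡 4) x).symm (extChartAt (𝓡 4) x x)) ∈
      (extChartAt (𝓡 4) (ψ x)).source := by
    rw [extChartAt_to_inv]; exact mem_extChartAt_source _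
  rw [extD_apply, extDeriv_inChart_pullback hη hψ hy hx,
    ← inChart_self (ConformalForms.pullback ψ (ConformalForms.extD η)) x,
    inChart_pullback_apply _ hψ hy hx]
  exact congrArg (ContinuousAlternatingMap.compContinuousLinearMap · _)
    (inChart_extD hη ((extChartAt (𝓡 4) (ψ x)).map_source hx)).symm

theorem extD_const_smul {p : ℕ} (c : ℝ) (η : DForm M p) (x : M) :
    ConformalForms.extD (fun x => c • η x) x = c • ConformalForms.extD η x := by
  rw [extD_apply, extD_apply, inChart_smul]
  exact extDeriv_smul c (inChart η x)

theorem _root_.ContMDiff.isSmoothForm_ofFun {f : M → ℝ} (hf : ContMDiff (𝓡 4) 𝓘(ℝ, ℝ) ∞ f) :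
    IsSmoothForm (ofFun f) := by
  rw [isSmoothForm_ofFun_iff]
  intro x₀ y hy
  rw [← contMDiffAt_iff_contDiffAt]
  exact hf.contMDiffAt.comp y (contMDiffAt_extChartAt_symm hy)

theorem extD_sub {p : ℕ} {η θ : DForm M p} (hη : IsSmoothForm η) (hθ : IsSmoothForm θ) (x : M) :
    ConformalForms.extD (fun x => η x - θ x) x =
      ConformalForms.extD η x - ConformalForms.extD θ x := by
  rw [extD_apply, extD_apply, extD_apply]
  exact extDeriv_sub_apply
    ((hη.contDiffAt (mem_extChartAt_target x)).differentiableAt (by simp))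
    ((hθ.contDiffAt (mem_extChartAt_target x)).differentiableAt (by simp))

theorem extD_ofFun_apply (f : M → ℝ) (x : M) (v : Fin 1 → 𝔼) :
    ConformalForms.extD (ofFun f) x v =
      fderiv ℝ (fun z => f ((extChartAt (𝓡 4) x).symm z)) (extChartAt (𝓡 4) x x) (v 0) := by
  rw [extD_apply, inChart_ofFun, extDeriv_constOfIsEmpty]
  rfl

/-- The Leibniz rule for the product of a function with a form. -/
theorem extD_smul_apply {p : ℕ} {f : M → ℝ} {η : DForm M p} (hf : IsSmoothForm (ofFun f))
    (hη : IsSmoothForm η) (x : M) (v : Fin (p + 1) → 𝔼) :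
    ConformalForms.extD (fun x => f x • η x) x v = f x * ConformalForms.extD η x v +
      ∑ i : Fin (p + 1), (-1 : ℝ) ^ (i : ℕ) *
        (ConformalForms.extD (ofFun f) x (fun _ => v i) * η x (i.removeNth v)) := by
  have hx := mem_extChartAt_target (I := 𝓡 4) x
  have key := extDeriv_fun_smul_apply
    ((isSmoothForm_ofFun_iff.1 hf x _ hx).differentiableAt (by simp))
    ((hη.contDiffAt hx).differentiableAt (by simp)) v
  rw [inChart_self, extChartAt_to_inv] at key
  simp only [extD_ofFun_apply]
  rw [extD_apply, extD_apply, inChart_smul]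
  exact key

end Charts

/-! ### Smoothness of determinants and inverse matrices -/

section MatrixSmooth

variable {G : Type*} [NormedAddCommGroup G] [NormedSpace ℝ G] {y : G}

theorem contDiffAt_det {A : G → Matrix (Fin 4) (Fin 4) ℝ}
    (hA : ∀ i j, ContDiffAt ℝ ∞ (fun z => A z i j) y) :
    ContDiffAt ℝ ∞ (fun z => (A z).det) y := by
  simp only [Matrix.det_apply']
  exact ContDiffAt.sum fun σ _ => contDiffAt_const.mul (contDiffAt_prod fun i _ => hA _ _)

theorem contDiffAt_matrix_inv_apply {A : G → Matrix (Fin 4) (Fin 4) ℝ}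
    (hA : ∀ i j, ContDiffAt ℝ ∞ (fun z => A z i j) y) (hdet : (A y).det ≠ 0) (i j : Fin 4) :
    ContDiffAt ℝ ∞ (fun z => (A z)⁻¹ i j) y := by
  simp only [Matrix.inv_def, Ring.inverse_eq_inv', Matrix.smul_apply, smul_eq_mul,
    Matrix.adjugate_apply]
  refine ((contDiffAt_det hA).inv hdet).mul (contDiffAt_det fun k l => ?_)
  simp only [Matrix.updateRow_apply]
  split_ifs
  · exact contDiffAt_const
  · exact hA k l

end MatrixSmooth

/-! ### The metric, the volume form and the Hodge dual in charts -/

section Metric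

variable {M : Type*} [TopologicalSpace M] [ChartedSpace 𝔼 M] [IsManifold (𝓡 4) ∞ M]

theorem mfderiv_extChartAt_comp_symm {x₀ : M} {y : 𝔼} (hy : y ∈ (extChartAt (𝓡 4) x₀).target)
    (v : 𝔼) :
    mfderiv (𝓡 4) 𝓘(ℝ, 𝔼) (extChartAt (𝓡 4) x₀) ((extChartAt (𝓡 4) x₀).symm y)
      (mfderiv 𝓘(ℝ, 𝔼) (𝓡 4) (extChartAt (𝓡 4) x₀).symm y v) = v := by
  have h := mfderiv_extChartAt_comp_mfderivWithin_extChartAt_symm (I := 𝓡 4) hy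
  rw [ModelWithCorners.range_eq_univ, mfderivWithin_univ] at h
  exact DFunLike.congr_fun h v

theorem mfderiv_symm_comp_extChartAt {x₀ : M} {y : 𝔼} (hy : y ∈ (extChartAt (𝓡 4) x₀).target)
    (v : TangentSpace (𝓡 4) ((extChartAt (𝓡 4) x₀).symm y)) :
    mfderiv 𝓘(ℝ, 𝔼) (𝓡 4) (extChartAt (𝓡 4) x₀).symm y
      (mfderiv (𝓡 4) 𝓘(ℝ, 𝔼) (extChartAt (𝓡 4) x₀) ((extChartAt (𝓡 4) x₀).symm y) v) = v := by
  have h := mfderivWithin_extChartAt_symm_comp_mfderiv_extChartAt (I := 𝓡 4) hy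
  rw [ModelWithCorners.range_eq_univ, mfderivWithin_univ] at h
  exact DFunLike.congr_fun h v

theorem trivializationAt_apply_snd {x₀ x : M} (hx : x ∈ (extChartAt (𝓡 4) x₀).source)
    (v : TangentSpace (𝓡 4) x) :
    (trivializationAt 𝔼 (TangentSpace (𝓡 4)) x₀ ⟨x, v⟩).2 =
      mfderiv (𝓡 4) 𝓘(ℝ, 𝔼) (extChartAt (𝓡 4) x₀) x v := by
  have hx' : x ∈ (chartAt 𝔼 x₀).source := by simpa using hx
  have h : (trivializationAt 𝔼 (TangentSpace (𝓡 4)) x₀).continuousLinearMapAt ℝ x v =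
      (trivializationAt 𝔼 (TangentSpace (𝓡 4)) x₀ ⟨x, v⟩).2 := by
    rw [Bundle.Trivialization.continuousLinearMapAt_apply,
      Bundle.Trivialization.coe_linearMapAt_of_mem]
    simpa using hx'
  exact h.symm.trans
    (DFunLike.congr_fun (TangentBundle.continuousLinearMapAt_trivializationAt hx') v)

/-- The coordinate vector fields of a chart are smooth. -/
theorem contMDiffAt_coordField {x₀ : M} {y : 𝔼} (hy : y ∈ (extChartAt (𝓡 4) x₀).target) (v : 𝔼) :
    ContMDiffAt 𝓘(ℝ, 𝔼) ((𝓡 4).prod 𝓘(ℝ, 𝔼)) ∞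
      (fun z => Bundle.TotalSpace.mk' 𝔼 (E := fun x : M => TangentSpace (𝓡 4) x)
        ((extChartAt (𝓡 4) x₀).symm z)
        (mfderiv 𝓘(ℝ, 𝔼) (𝓡 4) (extChartAt (𝓡 4) x₀).symm z v)) y := by
  have hs : (extChartAt (𝓡 4) x₀).symm y ∈ (extChartAt (𝓡 4) x₀).source :=
    (extChartAt (𝓡 4) x₀).map_target hy
  rw [Bundle.Trivialization.contMDiffAt_iff (e := trivializationAt 𝔼 (TangentSpace (𝓡 4)) x₀)]
  · refine ⟨contMDiffAt_extChartAt_symm hy, ?_⟩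
    refine (contMDiffAt_const (c := v)).congr_of_eventuallyEq ?_
    filter_upwards [extChartAt_target_mem_nhds_of_mem hy] with z hz
    exact (trivializationAt_apply_snd ((extChartAt (𝓡 4) x₀).map_target hz) _).trans
      (mfderiv_extChartAt_comp_symm hz v)
  · rw [Bundle.Trivialization.mem_source]
    simpa using hs

namespace LorentzMetric

variable (g : LorentzMetric M)

/-- The metric written in the chart at `x₀`. -/
def inChart (x₀ : M) (y : 𝔼) : LinearMap.BilinForm ℝ 𝔼 :=
  (g.bilin ((extChartAt (𝓡 4) x₀).symm y)).comp
    (mfderiv 𝓘(ℝ, 𝔼) (𝓡 4) (extChartAt (𝓡 4) x₀).symm y).toLinearMap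
    (mfderiv 𝓘(ℝ, 𝔼) (𝓡 4) (extChartAt (𝓡 4) x₀).symm y).toLinearMap

theorem inChart_apply (x₀ : M) (y v w : 𝔼) :
    g.inChart x₀ y v w = g.val ((extChartAt (𝓡 4) x₀).symm y)
      (mfderiv 𝓘(ℝ, 𝔼) (𝓡 4) (extChartAt (𝓡 4) x₀).symm y v)
      (mfderiv 𝓘(ℝ, 𝔼) (𝓡 4) (extChartAt (𝓡 4) x₀).symm y w) := rfl

variable {g} {x₀ : M} {y : 𝔼}

theorem isLorentzian_inChart (hy : y ∈ (extChartAt (𝓡 4) x₀).target) :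
    IsLorentzian (g.inChart x₀ y) := by
  obtain ⟨b, hb⟩ := g.lorentzian ((extChartAt (𝓡 4) x₀).symm y)
  let L : TangentSpace (𝓡 4) ((extChartAt (𝓡 4) x₀).symm y) ≃ₗ[ℝ] 𝔼 :=
    { (mfderiv (𝓡 4) 𝓘(ℝ, 𝔼) (extChartAt (𝓡 4) x₀)
        ((extChartAt (𝓡 4) x₀).symm y)).toLinearMap with
      invFun := fun v => mfderiv 𝓘(ℝ, 𝔼) (𝓡 4) (extChartAt (𝓡 4) x₀).symm y v
      left_inv := fun v => mfderiv_symm_comp_extChartAt hy v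
      right_inv := fun v => mfderiv_extChartAt_comp_symm hy v }
  have hL : ∀ v, mfderiv 𝓘(ℝ, 𝔼) (𝓡 4) (extChartAt (𝓡 4) x₀).symm y (L v) = v :=
    fun v => mfderiv_symm_comp_extChartAt hy v
  refine ⟨b.map L, fun i j => ?_⟩
  rw [inChart_apply, Basis.map_apply, Basis.map_apply, hL, hL]
  exact hb i j

theorem contDiffAt_inChart (hy : y ∈ (extChartAt (𝓡 4) x₀).target) (v w : 𝔼) :
    ContDiffAt ℝ ∞ (fun z => g.inChart x₀ z v w) y := by
  have h := ContMDiffAt.clm_bundle_apply₂ (E₃ := fun _ : M => ℝ)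
    (g.contMDiff.contMDiffAt.comp y (contMDiffAt_extChartAt_symm hy))
    (contMDiffAt_coordField hy v) (contMDiffAt_coordField hy w)
  rw [Bundle.contMDiffAt_totalSpace] at h
  exact contMDiffAt_iff_contDiffAt.1 h.2

theorem contDiffAt_inChart_gram (hy : y ∈ (extChartAt (𝓡 4) x₀).target) (i j : Fin 4) :
    ContDiffAt ℝ ∞ (fun z => LinearMap.BilinForm.toMatrix stdBasis (g.inChart x₀ z) i j) y := by
  simp only [LinearMap.BilinForm.toMatrix_apply]
  exact contDiffAt_inChart hy _ _

theorem det_inChart_ne_zero (hy : y ∈ (extChartAt (𝓡 4) x₀).target) :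
    (LinearMap.BilinForm.toMatrix stdBasis (g.inChart x₀ y)).det ≠ 0 :=
  (LinearMap.BilinForm.nondegenerate_iff_det_ne_zero _).1 (isLorentzian_inChart hy).nondegenerate

/-- The coordinates of the dual vectors are the rows of the inverse Gram matrix. An auxiliary
function `d` is used because the dual basis requires nondegeneracy, which is known only on the
target of the chart. -/
theorem contDiffAt_dualBasis (hy : y ∈ (extChartAt (𝓡 4) x₀).target) (i : Fin 4) :
    ∃ d : 𝔼 → 𝔼, ContDiffAt ℝ ∞ d y ∧ ∀ z (hz : z ∈ (extChartAt (𝓡 4) x₀).target),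
      (g.inChart x₀ z).dualBasis (isLorentzian_inChart hz).nondegenerate stdBasis i = d z := by
  let A : 𝔼 → Matrix (Fin 4) (Fin 4) ℝ := fun z =>
    LinearMap.BilinForm.toMatrix stdBasis (g.inChart x₀ z)
  refine ⟨fun z => ∑ k, (A z)⁻¹ i k • stdBasis k, ?_, fun z hz => ?_⟩
  · exact ContDiffAt.sum fun k _ => (contDiffAt_matrix_inv_apply
      (fun i j => contDiffAt_inChart_gram hy i j) (det_inChart_ne_zero hy) i k).smul
      contDiffAt_const
  · have hnd := (isLorentzian_inChart (g := g) hz).nondegenerate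
    let C : Matrix (Fin 4) (Fin 4) ℝ := Matrix.of fun i k =>
      stdBasis.repr ((g.inChart x₀ z).dualBasis hnd stdBasis i) k
    have hC : C * A z = 1 := by
      ext a b
      rw [Matrix.mul_apply, Matrix.one_apply]
      have := LinearMap.BilinForm.apply_dualBasis_left hnd stdBasis a b
      rw [← stdBasis.sum_repr ((g.inChart x₀ z).dualBasis hnd stdBasis a)] at this
      simp only [map_sum, map_smul, LinearMap.sum_apply, LinearMap.smul_apply, smul_eq_mul] at this
      simp only [C, A, Matrix.of_apply, LinearMap.BilinForm.toMatrix_apply]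
      rw [this]
      simp only [eq_comm]
    conv_lhs => rw [← stdBasis.sum_repr ((g.inChart x₀ z).dualBasis hnd stdBasis i)]
    have hi : (A z)⁻¹ = C := Matrix.inv_eq_left_inv hC
    change _ = ∑ k, (A z)⁻¹ i k • stdBasis k
    rw [hi]
    rfl

variable (o : ManifoldOrientation M)

theorem inChart_volumeForm_sq (v : Fin 4 → 𝔼) :
    ConformalForms.inChart (g.volumeForm o) x₀ y v ^ 2 =
      |(Matrix.of fun i j => g.inChart x₀ y (v i) (v j)).det| :=
  volumeCovector_sq (g.bilin ((extChartAt (𝓡 4) x₀).symm y)) _ _ _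

theorem top_form_apply (μ : 𝔼 [⋀^Fin 4]→L[ℝ] ℝ) (v : Fin 4 → 𝔼) :
    μ v = μ stdBasis * stdBasis.det v :=
  congrArg (fun f : 𝔼 [⋀^Fin 4]→ₗ[ℝ] ℝ => f v)
    (AlternatingMap.eq_smul_basis_det stdBasis μ.toAlternatingMap)

/-- Near each point of a chart there is a continuous function with the sign of the volume form on
the coordinate frame. -/
theorem exists_continuousAt_mul_volumeForm_pos (hy : y ∈ (extChartAt (𝓡 4) x₀).target) :
    ∃ d : 𝔼 → ℝ, ContinuousAt d y ∧
      ∀ᶠ z in 𝓝 y, 0 < ConformalForms.inChart (g.volumeForm o) x₀ z stdBasis * d z := by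
  have hs : (extChartAt (𝓡 4) x₀).symm y ∈ (extChartAt (𝓡 4) x₀).source :=
    (extChartAt (𝓡 4) x₀).map_target hy
  obtain ⟨U, hU, s, hsU, ho⟩ := o.exists_frame ((extChartAt (𝓡 4) x₀).symm y)
  let w : 𝔼 → Fin 4 → 𝔼 := fun z i =>
    mfderiv (𝓡 4) 𝓘(ℝ, 𝔼) (extChartAt (𝓡 4) x₀) ((extChartAt (𝓡 4) x₀).symm z)
      (s i ((extChartAt (𝓡 4) x₀).symm z))
  have hc : ContinuousAt (extChartAt (𝓡 4) x₀).symm y := continuousAt_extChartAt_symm'' hy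
  have hw : ∀ i, ContinuousAt (fun z => w z i) y := by
    intro i
    have h1 := (hsU.contMDiffOn i).contMDiffAt hU
    rw [Bundle.Trivialization.contMDiffAt_section_iff
      (trivializationAt 𝔼 (TangentSpace (𝓡 4)) x₀) (by simpa using hs)] at h1
    refine ContinuousAt.congr (ContinuousAt.comp (x := y) h1.continuousAt hc) ?_
    filter_upwards [extChartAt_target_mem_nhds_of_mem hy] with z hz
    exact trivializationAt_apply_snd ((extChartAt (𝓡 4) x₀).map_target hz) _
  refine ⟨fun z => stdBasis.det (w z), ?_, ?_⟩
  · have hd : Continuous fun v : Fin 4 → 𝔼 => stdBasis.det v := (basisDet stdBasis).cont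
    exact hd.continuousAt.comp (continuousAt_pi.2 hw)
  · filter_upwards [extChartAt_target_mem_nhds_of_mem hy, hc.preimage_mem_nhds hU] with z hz hzU
    -- The product is the volume form evaluated on the oriented frame itself, hence positive.
    rw [← top_form_apply]
    have hpos := volumeCovector_pos (g.nondegenerate ((extChartAt (𝓡 4) x₀).symm z))
      (coordBasis _) (hsU.toBasisAt hzU) (o.val _) (ho _ hzU)
    have hval : ConformalForms.inChart (g.volumeForm o) x₀ z (w z) =
        g.volumeForm o ((extChartAt (𝓡 4) x₀).symm z) (hsU.toBasisAt hzU) := by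
      change g.volumeForm o _ (fun i => mfderiv 𝓘(ℝ, 𝔼) (𝓡 4) (extChartAt (𝓡 4) x₀).symm z
        (w z i)) = _
      refine congrArg _ (funext fun i => ?_)
      rw [IsLocalFrameOn.toBasisAt_coe]
      exact mfderiv_symm_comp_extChartAt hz _
    rw [hval]
    exact hpos

/-- The coefficient on the coordinate frame has absolute value √|det g|, which is smooth as the
determinant does not vanish. The oriented frame fixes its sign near each point. -/
theorem isSmoothForm_volumeForm : IsSmoothForm (g.volumeForm o) := by
  refine isSmoothForm_of_contDiffAt fun x₀ y hy => ?_
  let c : 𝔼 → ℝ := fun z => ConformalForms.inChart (g.volumeForm o) x₀ z stdBasis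
  let D : 𝔼 → ℝ := fun z => (LinearMap.BilinForm.toMatrix stdBasis (g.inChart x₀ z)).det
  have hcD : ∀ z, |c z| = Real.sqrt |D z| := by
    intro z
    rw [← Real.sqrt_sq_eq_abs]
    congr 1
    have : LinearMap.BilinForm.toMatrix stdBasis (g.inChart x₀ z) =
        Matrix.of fun i j => g.inChart x₀ z (stdBasis i) (stdBasis j) := by
      ext i j
      rw [LinearMap.BilinForm.toMatrix_apply, Matrix.of_apply]
    simp only [c, D, this, inChart_volumeForm_sq]
  have hD : ContDiffAt ℝ ∞ (fun z => Real.sqrt |D z|) y := by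
    have hne := det_inChart_ne_zero (g := g) hy
    have h1 : ContDiffAt ℝ ∞ D y := contDiffAt_det fun i j => contDiffAt_inChart_gram hy i j
    exact (ContDiffAt.comp y (contDiffAt_abs hne) h1).sqrt (abs_ne_zero.2 hne)
  have hc : ContDiffAt ℝ ∞ c y := by
    obtain ⟨d, hd, hpos⟩ := exists_continuousAt_mul_volumeForm_pos (g := g) o hy
    have hdy : d y ≠ 0 := fun h => by simpa [h] using hpos.self_of_nhds
    rcases lt_or_gt_of_ne hdy with h | h
    · refine hD.neg.congr_of_eventuallyEq ?_
      filter_upwards [hpos, hd.eventually_lt_const h] with z hz hz'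
      have : c z < 0 := neg_of_mul_pos_left hz hz'.le
      rw [← hcD, abs_of_neg this, neg_neg]
    · refine hD.congr_of_eventuallyEq ?_
      filter_upwards [hpos, hd.eventually_const_lt h] with z hz hz'
      have : 0 < c z := pos_of_mul_pos_left hz hz'.le
      rw [← hcD, abs_of_pos this]
  rw [contDiffAt_form_iff]
  intro a
  refine ContDiffAt.congr_of_eventuallyEq (hc.mul (contDiffAt_const
    (c := stdBasis.det fun i => stdBasis (a i)))) (Eventually.of_forall fun z => ?_)
  exact top_form_apply _ _

/-- The inverse chart is by construction an isometry from the pulled-back metric, so naturality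
holds with no scaling. -/
theorem inChart_hodge {p q : ℕ} (h : p + q = 4) (η : DForm M p)
    (hy : y ∈ (extChartAt (𝓡 4) x₀).target) :
    ConformalForms.inChart (g.hodge o h η) x₀ y =
      hodgeCovector h (g.inChart x₀ y) (isLorentzian_inChart hy).nondegenerate stdBasis
        (ConformalForms.inChart (g.volumeForm o) x₀ y) (ConformalForms.inChart η x₀ y) :=
  hodgeCovector_comp_of_isometry h (isLorentzian_inChart (g := g) hy).nondegenerate
    (g.nondegenerate ((extChartAt (𝓡 4) x₀).symm y)) stdBasis (coordBasis _)
    (mfderiv 𝓘(ℝ, 𝔼) (𝓡 4) (extChartAt (𝓡 4) x₀).symm y) (fun _ _ => rfl)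
    (g.volumeForm o _) (η _)

end LorentzMetric

theorem IsSmoothForm.hodge {g : LorentzMetric M} (o : ManifoldOrientation M) {p q : ℕ}
    (h : p + q = 4) {η : DForm M p} (hη : IsSmoothForm η) : IsSmoothForm (g.hodge o h η) := by
  refine isSmoothForm_of_contDiffAt fun x₀ y hy => contDiffAt_form_iff.2 fun c => ?_
  choose d hd hdz using fun i => LorentzMetric.contDiffAt_dualBasis (g := g) hy i
  have key : ContDiffAt ℝ ∞ (fun z => (p.factorial : ℝ)⁻¹ * ∑ a : Fin p → Fin 4,
      inChart η x₀ z (fun i => d (a i) z) * inChart (g.volumeForm o) x₀ z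
        (fun i => Fin.append (fun i => stdBasis (a i)) (fun i => stdBasis (c i))
          (Fin.cast h.symm i))) y := by
    refine contDiffAt_const.mul (ContDiffAt.sum fun a _ => ContDiffAt.mul ?_ ?_)
    · exact contDiffAt_form_apply (hη.contDiffAt hy) fun i => hd (a i)
    · exact contDiffAt_form_apply ((LorentzMetric.isSmoothForm_volumeForm o).contDiffAt hy)
        fun i => contDiffAt_const
  refine key.congr_of_eventuallyEq ?_
  filter_upwards [extChartAt_target_mem_nhds_of_mem hy] with z hz
  rw [LorentzMetric.inChart_hodge o h η hz, hodgeCovector_apply]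
  simp only [hdz _ z hz]

theorem IsSmoothForm.codiff {g : LorentzMetric M} (o : ManifoldOrientation M) {p q : ℕ}
    (h : p + 1 + q = 4) {η : DForm M (p + 1)} (hη : IsSmoothForm η) :
    IsSmoothForm (g.codiff o h η) :=
  (hη.hodge o h).extD.hodge o _

end Metric

/-! ### Pull-backs and the chain rule for functions -/

variable {M : Type*} [TopologicalSpace M] [ChartedSpace 𝔼 M]
variable {N : Type*} [TopologicalSpace N] [ChartedSpace 𝔼 N]

theorem pullback_apply {p : ℕ} (ψ : M → N) (η : DForm N p) (x : M)
    (v : Fin p → TangentSpace (𝓡 4) x) :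
    pullback ψ η x v = η (ψ x) (fun i => mfderiv (𝓡 4) (𝓡 4) ψ x (v i)) := rfl

theorem pullback_add_apply {p : ℕ} (ψ : M → N) (η θ : DForm N p) (x : M) :
    pullback ψ (η + θ) x = pullback ψ η x + pullback ψ θ x := rfl

theorem ofFun_apply (f : M → ℝ) (x : M) (v : Fin 0 → TangentSpace (𝓡 4) x) :
    ofFun f x v = f x := rfl

theorem eq_zero_of_pullback_eq_zero {p : ℕ} (ψ : M ≃ₘ^∞⟮𝓡 4, 𝓡 4⟯ N) {η : DForm N p}
    (h : pullback ψ η = 0) : η = 0 := by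
  funext y
  obtain ⟨x, rfl⟩ := ψ.surjective y
  ext v
  let L := ψ.mfderivToContinuousLinearEquiv (by simp) x
  have hx := congrArg (fun ζ : TangentSpace (𝓡 4) x [⋀^Fin p]→L[ℝ] ℝ =>
    ζ fun i => L.symm (v i)) (congrFun h x)
  have hv : (fun i => mfderiv (𝓡 4) (𝓡 4) ψ x (L.symm (v i))) = v :=
    funext fun i => L.apply_symm_apply (v i)
  have hx' : η (ψ x) (fun i => mfderiv (𝓡 4) (𝓡 4) ψ x (L.symm (v i))) = 0 := hx
  rw [hv] at hx'
  exact hx'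

variable [IsManifold (𝓡 4) ∞ M] [IsManifold (𝓡 4) ∞ N]

theorem extD_ofFun_comp {f : M → ℝ} (hf : IsSmoothForm (ofFun f)) {h : ℝ → ℝ} {h' : ℝ} {x : M}
    (hh : HasDerivAt h h' (f x)) :
    extD (ofFun fun z => h (f z)) x = h' • extD (ofFun f) x := by
  ext v
  have hx := mem_extChartAt_target (I := 𝓡 4) x
  have hd : HasFDerivAt (fun z => f ((extChartAt (𝓡 4) x).symm z)) _ (extChartAt (𝓡 4) x x) :=
    ((isSmoothForm_ofFun_iff.1 hf x _ hx).differentiableAt (by simp)).hasFDerivAt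
  have hh' : HasDerivAt h h' (f ((extChartAt (𝓡 4) x).symm (extChartAt (𝓡 4) x x))) := by
    rwa [extChartAt_to_inv]
  have key := (HasDerivAt.comp_hasFDerivAt (f := fun z => f ((extChartAt (𝓡 4) x).symm z))
    (extChartAt (𝓡 4) x x) hh' hd).fderiv
  exact ((extD_ofFun_apply (fun z => h (f z)) x v).trans (DFunLike.congr_fun key (v 0))).trans
    (congrArg (h' * ·) (extD_ofFun_apply f x v).symm)

/-! ### Product rule for the codifferential of 1-forms -/

namespace LorentzMetric

variable (g : LorentzMetric M) (o : ManifoldOrientation M)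

theorem volumeForm_sq (x : M) (v : Fin 4 → TangentSpace (𝓡 4) x) :
    g.volumeForm o x v ^ 2 = |(Matrix.of fun i j => g.val x (v i) (v j)).det| :=
  volumeCovector_sq (g.bilin x) _ _ v

theorem hodge_smul {p q : ℕ} (h : p + q = 4) (f : M → ℝ) (η : DForm M p) :
    g.hodge o h (fun x => f x • η x) = fun x => f x • g.hodge o h η x :=
  funext fun _ => hodgeCovector_smul _ _ _ _ _ _ _

theorem hodge_smul_apply {p q : ℕ} (h : p + q = 4) (f : M → ℝ) (η : DForm M p) (x : M)
    (v : Fin q → TangentSpace (𝓡 4) x) :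
    g.hodge o h (fun x => f x • η x) x v = f x * g.hodge o h η x v := by
  rw [hodge_smul]
  rfl

theorem apply_sharp_eq (x : M) (α : TangentSpace (𝓡 4) x [⋀^Fin 1]→L[ℝ] ℝ)
    (v : TangentSpace (𝓡 4) x) : g.bilin x (g.sharp x α) v = α (fun _ => v) := by
  rw [← LinearMap.BilinForm.toDual_def (g.nondegenerate x), sharp, LinearEquiv.apply_symm_apply]
  rfl

/-- The product rule for the exterior derivative of a multiple of the dual of a `1`-form. -/
theorem extD_smul_hodge {f : M → ℝ} (hf : IsSmoothForm (ofFun f)) {η : DForm M 1}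
    (hη : IsSmoothForm η) (h : 1 + 3 = 4) (x : M) :
    extD (fun x => f x • g.hodge o h η x) x =
      f x • extD (g.hodge o h η) x + g.pairing (extD (ofFun f)) η x • g.volumeForm o x := by
  refine ContinuousAlternatingMap.toAlternatingMap_injective
    (ext_alternating_of_basis (coordBasis x) ?_)
  change extD (fun x => f x • g.hodge o h η x) x (coordBasis x) =
    f x * extD (g.hodge o h η) x (coordBasis x) +
      extD (ofFun f) x (fun _ => g.sharp x (η x)) * g.volumeForm o x (coordBasis x)
  have key := extD_smul_apply hf (hη.hodge (g := g) o h) x (coordBasis x)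
  refine key.trans ?_
  congr 1
  -- With *η the contraction of the volume form with η^♯, this identity is df ∧ *η = df(η^♯) μ.
  have hw := sum_neg_one_pow_mul_cons_removeNth (g.volumeForm o x).toAlternatingMap (coordBasis x)
    ((ContinuousAlternatingMap.ofSubsingleton ℝ (TangentSpace (𝓡 4) x) ℝ (0 : Fin 1)).symm
      (extD (ofFun f) x)).toLinearMap (g.sharp x (η x))
  refine Eq.trans (Finset.sum_congr rfl fun i _ => ?_) hw
  congr 2
  exact hodgeCovector_one h (g.nondegenerate x) (g.symm x) (coordBasis x) (g.volumeForm o x) (η x)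
    (g.sharp x (η x)) (g.apply_sharp_eq x (η x)) _

theorem hodge_volumeForm (h : 4 + 0 = 4) (x : M) (v : Fin 0 → TangentSpace (𝓡 4) x) :
    g.hodge o h (g.volumeForm o) x v = -1 :=
  hodgeCovector_volume h (g.nondegenerate x) (g.lorentzian x) (coordBasis x) (g.volumeForm o x)
    (g.volumeForm_sq o x) v

theorem hodge_add_apply {p q : ℕ} (h : p + q = 4) (η θ : DForm M p) (x : M)
    (v : Fin q → TangentSpace (𝓡 4) x) :
    g.hodge o h (fun x => η x + θ x) x v = g.hodge o h η x v + g.hodge o h θ x v :=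
  congrArg (fun ζ : TangentSpace (𝓡 4) x [⋀^Fin q]→L[ℝ] ℝ => ζ v)
    (hodgeCovector_add h (g.bilin x) (g.nondegenerate x) (coordBasis x) (g.volumeForm o x) (η x)
      (θ x))

theorem codiff₁_eq (η : DForm M 1) :
    g.codiff₁ o η = g.codiff o (p := 0) (q := 3) (by norm_num) η := rfl

theorem codiff₂_eq (η : DForm M 2) :
    g.codiff₂ o η = g.codiff o (p := 1) (q := 2) (by norm_num) η := rfl

theorem box_eq (η : DForm M 1) : g.box o η = extD (g.codiff₁ o η) + g.codiff₂ o (extD η) := rfl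

/-- The product rule for the codifferential of `1`-forms. -/
theorem codiff₁_smul {f : M → ℝ} (hf : IsSmoothForm (ofFun f)) {η : DForm M 1}
    (hη : IsSmoothForm η) (x : M) :
    g.codiff₁ o (fun x => f x • η x) x =
      f x • g.codiff₁ o η x - ofFun (g.pairing (extD (ofFun f)) η) x := by
  ext v
  have h1 : g.codiff₁ o (fun x => f x • η x) =
      g.hodge o (by norm_num) (fun x => f x • extD (g.hodge o (by norm_num : 1 + 3 = 4) η) x +
        g.pairing (extD (ofFun f)) η x • g.volumeForm o x) := by
    rw [codiff₁_eq, codiff]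
    rw [hodge_smul]
    congr 1
    exact funext fun x => extD_smul_hodge g o hf hη _ x
  rw [h1, hodge_add_apply, hodge_smul_apply, hodge_smul_apply, hodge_volumeForm,
    ContinuousAlternatingMap.sub_apply, ContinuousAlternatingMap.smul_apply, codiff₁_eq, codiff,
    ofFun_apply, mul_neg_one, smul_eq_mul, ← sub_eq_add_neg]

end LorentzMetric

/-! ### Conformal transformation of the volume form, the Hodge dual and the operators -/

namespace IsConformalIsometry

variable {g : LorentzMetric M} {g' : LorentzMetric N} {ψ : M ≃ₘ^∞⟮𝓡 4, 𝓡 4⟯ N} {Ξ : M → ℝ}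

theorem pullback_volumeForm_sq (hψ : IsConformalIsometry g g' ψ Ξ) (o : ManifoldOrientation M)
    (o' : ManifoldOrientation N) (x : M) (v : Fin 4 → TangentSpace (𝓡 4) x) :
    pullback ψ (g'.volumeForm o') x v ^ 2 = (Ξ x ^ 4 * g.volumeForm o x v) ^ 2 := by
  have hm : (Matrix.of fun i j => g'.val (ψ x) (mfderiv (𝓡 4) (𝓡 4) ψ x (v i))
      (mfderiv (𝓡 4) (𝓡 4) ψ x (v j))) =
      Ξ x ^ 2 • Matrix.of fun i j => g.val x (v i) (v j) := by
    ext i j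
    exact hψ.pullback_eq x (v i) (v j)
  rw [pullback_apply, LorentzMetric.volumeForm_sq, hm, mul_pow, LorentzMetric.volumeForm_sq,
    Matrix.det_smul, abs_mul, abs_of_nonneg (by positivity), Fintype.card_fin]
  ring

/-- Equality of squares gives a sign at every point. The sign is locally constant because both
volume forms have continuous, nonvanishing coefficients in a chart, so connectedness makes it
global. -/
theorem exists_pullback_volumeForm_eq [PreconnectedSpace M] (hψ : IsConformalIsometry g g' ψ Ξ)
    (o : ManifoldOrientation M) (o' : ManifoldOrientation N) :
    ∃ c : ℝ, c * c = 1 ∧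
      ∀ x, pullback ψ (g'.volumeForm o') x = (c * Ξ x ^ 4) • g.volumeForm o x := by
  have hpt : ∀ x, ∃ c : ℝ, (c = 1 ∨ c = -1) ∧
      pullback ψ (g'.volumeForm o') x = (c * Ξ x ^ 4) • g.volumeForm o x := by
    intro x
    have hext : ∀ c : ℝ, pullback ψ (g'.volumeForm o') x (coordBasis x) =
        c * Ξ x ^ 4 * g.volumeForm o x (coordBasis x) →
        pullback ψ (g'.volumeForm o') x = (c * Ξ x ^ 4) • g.volumeForm o x := fun c hc =>
      ContinuousAlternatingMap.toAlternatingMap_injective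
        (ext_alternating_of_basis (coordBasis x) hc)
    rcases sq_eq_sq_iff_eq_or_eq_neg.1 (hψ.pullback_volumeForm_sq o o' x (coordBasis x)) with h | h
    · exact ⟨1, Or.inl rfl, hext 1 (by rw [h]; ring)⟩
    · exact ⟨-1, Or.inr rfl, hext (-1) (by rw [h]; ring)⟩
  choose c hc hcx using hpt
  have hloc : IsLocallyConstant c := by
    rw [IsLocallyConstant.iff_eventually_eq]
    intro x
    -- The product of the two coefficients is continuous and has the same sign as `c`.
    let u : 𝔼 → ℝ := fun z => inChart (g.volumeForm o) x z stdBasis *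
      inChart (pullback ψ (g'.volumeForm o')) x z stdBasis
    have hx := mem_extChartAt_target (I := 𝓡 4) x
    have hu : ContinuousAt u (extChartAt (𝓡 4) x x) :=
      ((contDiffAt_form_iff.1 ((LorentzMetric.isSmoothForm_volumeForm (g := g) o).contDiffAt hx)
        id).continuousAt).mul ((contDiffAt_form_iff.1 (((LorentzMetric.isSmoothForm_volumeForm
        (g := g') o').pullback ψ.contMDiff).contDiffAt hx) id).continuousAt)
    have huc : ∀ z ∈ (extChartAt (𝓡 4) x).target,
        0 < c ((extChartAt (𝓡 4) x).symm z) * u z := by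
      intro z hz
      have h0 : inChart (g.volumeForm o) x z stdBasis ≠ 0 := by
        intro h0
        have h1 := LorentzMetric.inChart_volumeForm_sq (g := g) (x₀ := x) (y := z) o stdBasis
        rw [h0] at h1
        refine LorentzMetric.det_inChart_ne_zero (g := g) hz (abs_eq_zero.1 ?_)
        rw [zero_pow two_ne_zero] at h1
        rw [h1]
        congr 2
        ext i j
        rw [LinearMap.BilinForm.toMatrix_apply, Matrix.of_apply]
      have h2 : inChart (pullback ψ (g'.volumeForm o')) x z stdBasis =
          c ((extChartAt (𝓡 4) x).symm z) * Ξ ((extChartAt (𝓡 4) x).symm z) ^ 4 *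
            inChart (g.volumeForm o) x z stdBasis :=
        congrArg (fun ζ : TangentSpace (𝓡 4) ((extChartAt (𝓡 4) x).symm z) [⋀^Fin 4]→L[ℝ] ℝ =>
          ζ fun i => mfderiv 𝓘(ℝ, 𝔼) (𝓡 4) (extChartAt (𝓡 4) x).symm z (stdBasis i)) (hcx _)
      have h3 : c ((extChartAt (𝓡 4) x).symm z) ≠ 0 := by
        rcases hc ((extChartAt (𝓡 4) x).symm z) with h | h <;> rw [h] <;> norm_num
      have h4 := hψ.pos ((extChartAt (𝓡 4) x).symm z)
      have h5 : c ((extChartAt (𝓡 4) x).symm z) * u z =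
          c ((extChartAt (𝓡 4) x).symm z) ^ 2 * Ξ ((extChartAt (𝓡 4) x).symm z) ^ 4 *
            inChart (g.volumeForm o) x z stdBasis ^ 2 := by
        simp only [u, h2]; ring
      rw [h5]
      positivity
    have hux := huc _ hx
    rw [extChartAt_to_inv] at hux
    have hev : ∀ᶠ x' in 𝓝 x, 0 < c x * u (extChartAt (𝓡 4) x x') :=
      ((continuousAt_const.mul hu).comp (continuousAt_extChartAt x)).eventually_const_lt hux
    filter_upwards [hev, extChartAt_source_mem_nhds (I := 𝓡 4) x] with x' h1 hx'
    have h2 := huc _ ((extChartAt (𝓡 4) x).map_source hx')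
    rw [(extChartAt (𝓡 4) x).left_inv hx'] at h2
    rcases hc x with h | h <;> rcases hc x' with h' | h' <;> rw [h, h'] <;>
      rw [h] at h1 <;> rw [h'] at h2 <;> linarith
  rcases isEmpty_or_nonempty M with hM | ⟨⟨x₀⟩⟩
  · exact ⟨1, one_mul 1, fun x => isEmptyElim x⟩
  · refine ⟨c x₀, ?_, fun x => ?_⟩
    · rcases hc x₀ with h | h <;> rw [h] <;> norm_num
    · rw [hcx x, hloc.apply_eq_of_preconnectedSpace x x₀]

/-- Ξ⁴ comes from the volume form, and one factor Ξ⁻² from each of the p raised indices. -/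
theorem pullback_hodge (hψ : IsConformalIsometry g g' ψ Ξ) {o : ManifoldOrientation M}
    {o' : ManifoldOrientation N} {c : ℝ}
    (hc : ∀ x, pullback ψ (g'.volumeForm o') x = (c * Ξ x ^ 4) • g.volumeForm o x) {p q : ℕ}
    (h : p + q = 4) (η : DForm N p) :
    pullback ψ (g'.hodge o' h η) =
      fun x => (c * (Ξ x ^ 4 * (Ξ x ^ 2)⁻¹ ^ p)) • g.hodge o h (pullback ψ η) x := by
  funext x
  have h1 := hodgeCovector_comp h (g.nondegenerate x) (g'.nondegenerate (ψ x)) (coordBasis x)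
    (coordBasis (ψ x)) (mfderiv (𝓡 4) (𝓡 4) ψ x) (pow_ne_zero 2 (hψ.pos x).ne')
    (hψ.pullback_eq x) (g'.volumeForm o' (ψ x)) (η (ψ x))
  refine h1.trans ?_
  have h2 : (g'.volumeForm o' (ψ x)).compContinuousLinearMap (mfderiv (𝓡 4) (𝓡 4) ψ x) =
    (c * Ξ x ^ 4) • g.volumeForm o x := hc x
  rw [h2, hodgeCovector_smul_volume, smul_smul]
  change _ = (c * (Ξ x ^ 4 * (Ξ x ^ 2)⁻¹ ^ p)) • hodgeCovector h (g.bilin x) (g.nondegenerate x)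
    (coordBasis x) (g.volumeForm o x) ((η (ψ x)).compContinuousLinearMap _)
  congr 1
  ring

/-- The inner dual acts on (p+1)-forms and the outer one on (q+1)-forms, which explains the two
exponents. The constant `c` passes through d and meets itself as c² = 1. -/
theorem pullback_codiff [PreconnectedSpace M] (hψ : IsConformalIsometry g g' ψ Ξ)
    (o : ManifoldOrientation M) (o' : ManifoldOrientation N) {p q : ℕ} (h : p + 1 + q = 4)
    {η : DForm N (p + 1)} (hη : IsSmoothForm η) (x : M) :
    pullback ψ (g'.codiff o' h η) x = (Ξ x ^ 4 * (Ξ x ^ 2)⁻¹ ^ (q + 1)) •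
      g.codiff o h (fun x => (Ξ x ^ 4 * (Ξ x ^ 2)⁻¹ ^ (p + 1)) • pullback ψ η x) x := by
  obtain ⟨c, hcc, hc⟩ := hψ.exists_pullback_volumeForm_eq o o'
  have h1 : pullback ψ (extD (g'.hodge o' h η)) = fun x => c • extD (g.hodge o h
      (fun x => (Ξ x ^ 4 * (Ξ x ^ 2)⁻¹ ^ (p + 1)) • pullback ψ η x)) x := by
    rw [← extD_pullback (hη.hodge o' h) ψ.contMDiff, hψ.pullback_hodge hc, LorentzMetric.hodge_smul]
    funext x
    rw [← extD_const_smul]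
    simp only [smul_smul]
  have h2 := congrFun (hψ.pullback_hodge hc (by omega : q + 1 + p = 4)
    (extD (g'.hodge o' h η))) x
  refine h2.trans ?_
  rw [h1, LorentzMetric.hodge_smul, smul_smul]
  change _ = (Ξ x ^ 4 * (Ξ x ^ 2)⁻¹ ^ (q + 1)) • g.hodge o _ _ x
  congr 1
  linear_combination (Ξ x ^ 4 * (Ξ x ^ 2)⁻¹ ^ (q + 1)) * hcc

theorem isSmoothForm_factor (hψ : IsConformalIsometry g g' ψ Ξ) : IsSmoothForm (ofFun Ξ) :=
  hψ.smooth.isSmoothForm_ofFun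

theorem isSmoothForm_factor_sq (hψ : IsConformalIsometry g g' ψ Ξ) :
    IsSmoothForm (ofFun fun x => Ξ x ^ 2) :=
  (hψ.smooth.pow 2).isSmoothForm_ofFun

theorem isSmoothForm_factor_sq_inv (hψ : IsConformalIsometry g g' ψ Ξ) :
    IsSmoothForm (ofFun fun x => (Ξ x ^ 2)⁻¹) := by
  rw [isSmoothForm_ofFun_iff]
  intro x₀ y hy
  exact (isSmoothForm_ofFun_iff.1 hψ.isSmoothForm_factor_sq x₀ y hy).inv
    (pow_ne_zero 2 (hψ.pos _).ne')

theorem extD_factor_sq (hψ : IsConformalIsometry g g' ψ Ξ) (x : M) :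
    extD (ofFun fun x => Ξ x ^ 2) x = (2 * Ξ x ^ 2) • dlogForm Ξ x := by
  have h := extD_ofFun_comp hψ.isSmoothForm_factor (hasDerivAt_pow 2 (Ξ x))
  refine h.trans ?_
  rw [dlogForm, smul_smul]
  congr 1
  have := (hψ.pos x).ne'
  field_simp
  norm_num

theorem extD_factor_sq_inv (hψ : IsConformalIsometry g g' ψ Ξ) (x : M) :
    extD (ofFun fun x => (Ξ x ^ 2)⁻¹) x = (-2 * (Ξ x ^ 2)⁻¹) • dlogForm Ξ x := by
  have hne := (hψ.pos x).ne'
  have h := extD_ofFun_comp hψ.isSmoothForm_factor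
    ((hasDerivAt_pow 2 (Ξ x)).inv (pow_ne_zero 2 hne))
  refine h.trans ?_
  rw [dlogForm, smul_smul]
  congr 1
  field_simp
  norm_num [mul_comm]

theorem extD_factor_sq_inv_smul (hψ : IsConformalIsometry g g' ψ Ξ) {f : DForm M 0}
    (hf : IsSmoothForm f) (x : M) :
    extD (fun x => (Ξ x ^ 2)⁻¹ • f x) x =
      (Ξ x ^ 2)⁻¹ • (extD f x - (2 * toFun f x) • dlogForm Ξ x) := by
  ext v
  have e1 := extD_smul_apply hψ.isSmoothForm_factor_sq_inv hf x v
  rw [Fin.sum_univ_one] at e1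
  have e2 : extD (ofFun fun x => (Ξ x ^ 2)⁻¹) x (fun _ => v 0) =
      -2 * (Ξ x ^ 2)⁻¹ * dlogForm Ξ x v := by
    rw [hψ.extD_factor_sq_inv]
    have hv : (fun _ : Fin 1 => v 0) = v := funext fun i => by rw [Subsingleton.elim i 0]
    rw [hv]
    rfl
  have e3 : f x (Fin.removeNth 0 v) = toFun f x := congrArg (f x) (Subsingleton.elim _ _)
  refine e1.trans ?_
  change (Ξ x ^ 2)⁻¹ * extD f x v + (-1 : ℝ) ^ 0 *
    (extD (ofFun fun x => (Ξ x ^ 2)⁻¹) x (fun _ => v 0) * f x (Fin.removeNth 0 v)) =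
    (Ξ x ^ 2)⁻¹ * (extD f x v - 2 * toFun f x * dlogForm Ξ x v)
  rw [e2, e3]
  ring

variable [PreconnectedSpace M]

theorem pullback_codiff₁_eq (hψ : IsConformalIsometry g g' ψ Ξ) (o : ManifoldOrientation M)
    (o' : ManifoldOrientation N) {η : DForm N 1} (hη : IsSmoothForm η) (x : M) :
    pullback ψ (g'.codiff₁ o' η) x =
      (Ξ x ^ 4)⁻¹ • g.codiff₁ o (fun x => Ξ x ^ 2 • pullback ψ η x) x := by
  have h := hψ.pullback_codiff o o' (p := 0) (q := 3) (by norm_num) hη x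
  have h1 : ∀ x, Ξ x ^ 4 * (Ξ x ^ 2)⁻¹ ^ (0 + 1) = Ξ x ^ 2 := by
    intro x
    have := (hψ.pos x).ne'
    simp only [inv_pow]
    field_simp
    ring
  have h2 : Ξ x ^ 4 * (Ξ x ^ 2)⁻¹ ^ (3 + 1) = (Ξ x ^ 4)⁻¹ := by
    have := (hψ.pos x).ne'
    simp only [inv_pow]
    field_simp
    ring
  rw [h2] at h
  simp only [h1] at h
  refine h.trans ?_
  refine congrArg ((Ξ x ^ 4)⁻¹ • ·) ?_
  exact congrFun (g.codiff₁_eq o (fun x => Ξ x ^ 2 • pullback ψ η x)).symm x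

theorem pullback_codiff₁ (hψ : IsConformalIsometry g g' ψ Ξ) (o : ManifoldOrientation M)
    (o' : ManifoldOrientation N) {η : DForm N 1} (hη : IsSmoothForm η) (x : M) :
    pullback ψ (g'.codiff₁ o' η) x = (Ξ x ^ 2)⁻¹ • (g.codiff₁ o (pullback ψ η) x -
      (2 : ℝ) • ofFun (g.pairing (dlogForm Ξ) (pullback ψ η)) x) := by
  rw [hψ.pullback_codiff₁_eq o o' hη, g.codiff₁_smul o hψ.isSmoothForm_factor_sq
    (hη.pullback ψ.contMDiff)]
  ext v
  have hp : g.pairing (extD (ofFun fun x => Ξ x ^ 2)) (pullback ψ η) x =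
      2 * Ξ x ^ 2 * g.pairing (dlogForm Ξ) (pullback ψ η) x := by
    simp only [LorentzMetric.pairing, hψ.extD_factor_sq]
    rfl
  generalize g.codiff₁ o (pullback ψ η) = δ
  change (Ξ x ^ 4)⁻¹ * (Ξ x ^ 2 * δ x v -
    g.pairing (extD (ofFun fun x => Ξ x ^ 2)) (pullback ψ η) x) =
    (Ξ x ^ 2)⁻¹ * (δ x v - 2 * g.pairing (dlogForm Ξ) (pullback ψ η) x)
  rw [hp]
  have := (hψ.pos x).ne'
  field_simp

theorem pullback_codiff₂ (hψ : IsConformalIsometry g g' ψ Ξ) (o : ManifoldOrientation M)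
    (o' : ManifoldOrientation N) {η : DForm N 2} (hη : IsSmoothForm η) (x : M) :
    pullback ψ (g'.codiff₂ o' η) x = (Ξ x ^ 2)⁻¹ • g.codiff₂ o (pullback ψ η) x := by
  have h := hψ.pullback_codiff o o' (p := 1) (q := 2) (by norm_num) hη x
  have h1 : ∀ x, Ξ x ^ 4 * (Ξ x ^ 2)⁻¹ ^ (1 + 1) = 1 := by
    intro x
    have := (hψ.pos x).ne'
    simp only [inv_pow]
    field_simp
    ring
  have h2 : Ξ x ^ 4 * (Ξ x ^ 2)⁻¹ ^ (2 + 1) = (Ξ x ^ 2)⁻¹ := by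
    have := (hψ.pos x).ne'
    simp only [inv_pow]
    field_simp
    ring
  rw [h2] at h
  simp only [h1, one_smul] at h
  refine h.trans ?_
  refine congrArg ((Ξ x ^ 2)⁻¹ • ·) ?_
  exact congrFun (g.codiff₂_eq o (pullback ψ η)).symm x

theorem pullback_codiff₂_extD (hψ : IsConformalIsometry g g' ψ Ξ) (o : ManifoldOrientation M)
    (o' : ManifoldOrientation N) {η : DForm N 1} (hη : IsSmoothForm η) (x : M) :
    pullback ψ (g'.codiff₂ o' (extD η)) x =
      (Ξ x ^ 2)⁻¹ • g.codiff₂ o (extD (pullback ψ η)) x := by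
  rw [hψ.pullback_codiff₂ o o' hη.extD, extD_pullback hη ψ.contMDiff]

/-- The formula for the codifferential is solved for the pairing, whose other terms are already
known to be smooth; the smoothness of `sharp` need not be examined. -/
theorem isSmoothForm_pairing (hψ : IsConformalIsometry g g' ψ Ξ) (o : ManifoldOrientation M)
    (o' : ManifoldOrientation N) {η : DForm N 1} (hη : IsSmoothForm η) :
    IsSmoothForm (ofFun (g.pairing (dlogForm Ξ) (pullback ψ η))) := by
  have h1 : IsSmoothForm (pullback ψ (g'.codiff₁ o' η)) :=
    (IsSmoothForm.codiff o' (p := 0) (q := 3) (by norm_num) hη).pullback ψ.contMDiff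
  have h2 : IsSmoothForm (g.codiff₁ o (pullback ψ η)) :=
    IsSmoothForm.codiff o (p := 0) (q := 3) (by norm_num) (hη.pullback ψ.contMDiff)
  have h3 := (contMDiff_const (c := (2 : ℝ)⁻¹)).isSmoothForm_ofFun.smul
    (h2.sub (hψ.isSmoothForm_factor_sq.smul h1))
  convert h3 using 1
  funext x
  rw [hψ.pullback_codiff₁ o o' hη, smul_inv_smul₀ (pow_ne_zero 2 (hψ.pos x).ne'), sub_sub_cancel,
    inv_smul_smul₀ two_ne_zero]

theorem pullback_box (hψ : IsConformalIsometry g g' ψ Ξ) (o : ManifoldOrientation M)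
    (o' : ManifoldOrientation N) {η : DForm N 1} (hη : IsSmoothForm η) (x : M) :
    pullback ψ (g'.box o' η) x = (Ξ x ^ 2)⁻¹ • (g.box o (pullback ψ η) x -
      (2 : ℝ) • extD (ofFun (g.pairing (dlogForm Ξ) (pullback ψ η))) x +
      (2 * (2 * g.pairing (dlogForm Ξ) (pullback ψ η) x -
        toFun (g.codiff₁ o (pullback ψ η)) x)) • dlogForm Ξ x) := by
  have hδφ := hψ.pullback_codiff₁ o o' hη
  have hP := hψ.isSmoothForm_pairing o o' hη
  have hdd := hψ.pullback_codiff₂_extD o o' hη x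
  have hφs := hη.pullback ψ.contMDiff
  generalize pullback ψ η = φ at *
  have hδ : IsSmoothForm (g.codiff₁ o φ) :=
    IsSmoothForm.codiff o (p := 0) (q := 3) (by norm_num) hφs
  have hδ' : IsSmoothForm (g'.codiff₁ o' η) :=
    IsSmoothForm.codiff o' (p := 0) (q := 3) (by norm_num) hη
  have h2P : IsSmoothForm (fun x => (2 : ℝ) • ofFun (g.pairing (dlogForm Ξ) φ) x) :=
    (contMDiff_const (c := (2 : ℝ))).isSmoothForm_ofFun.smul hP
  have h0 := funext hδφ
  have hd := extD_pullback hδ' ψ.contMDiff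
  rw [h0] at hd
  -- Differentiating the factor Ξ⁻² produces -2 (δφ - 2 g⁻¹(Υ, φ)) Υ, the last term of the claim;
  -- `hdd` supplies the δd part.
  rw [LorentzMetric.box_eq, LorentzMetric.box_eq, pullback_add_apply, Pi.add_apply, ← hd, hdd,
    hψ.extD_factor_sq_inv_smul (hδ.sub h2P), extD_sub hδ h2P, extD_const_smul]
  generalize g.codiff₁ o φ = δ
  have ht : toFun (fun x => δ x - (2 : ℝ) • ofFun (g.pairing (dlogForm Ξ) φ) x) x =
      toFun δ x - 2 * g.pairing (dlogForm Ξ) φ x := rfl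
  rw [ht]
  module

end IsConformalIsometry

end ConformalForms

end

theorem mainTheorem12
    {M N : Type*}
    [TopologicalSpace M] [T2Space M] [SecondCountableTopology M] [PathConnectedSpace M]
    [ChartedSpace (EuclideanSpace ℝ (Fin 4)) M] [IsManifold (𝓡 4) ∞ M]
    [TopologicalSpace N] [T2Space N] [SecondCountableTopology N] [PathConnectedSpace N]
    [ChartedSpace (EuclideanSpace ℝ (Fin 4)) N] [IsManifold (𝓡 4) ∞ N]
    (g : LorentzMetric M) (o : ManifoldOrientation M)
    (g' : LorentzMetric N) (o' : ManifoldOrientation N)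
    (ψ : M ≃ₘ^∞⟮𝓡 4, 𝓡 4⟯ N) (Ξ : M → ℝ) (hψ : IsConformalIsometry g g' ψ Ξ)
    (φ' : DForm N 1) (hφ' : IsSmoothForm φ')
    (φ : DForm M 1) (hφ : φ = pullback ψ φ')
    (Υ : DForm M 1) (hΥ : Υ = dlogForm Ξ) :
    -- the codifferential
    (∀ x, pullback ψ (g'.codiff₁ o' φ') x =
      (Ξ x ^ 2)⁻¹ • (g.codiff₁ o φ x - (2 : ℝ) • ofFun (g.pairing Υ φ) x)) ∧
    -- the operator `δ d`
    (∀ x, pullback ψ (g'.codiff₂ o' (extD φ')) x =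
      (Ξ x ^ 2)⁻¹ • g.codiff₂ o (extD φ) x) ∧
    -- the Laplace–de Rham operator; the wedge product with a `0`-form is multiplication
    (∀ x, pullback ψ (g'.box o' φ') x =
      (Ξ x ^ 2)⁻¹ • (g.box o φ x - (2 : ℝ) • extD (ofFun (g.pairing Υ φ)) x
        + (2 * (2 * g.pairing Υ φ x - toFun (g.codiff₁ o φ) x)) • Υ x)) ∧
    -- conformal invariance of `δ d` on `1`-forms of weight `0`
    weightedPullback ψ Ξ (-2) (g'.codiff₂ o' (extD φ')) =
      g.codiff₂ o (extD (weightedPullback ψ Ξ 0 φ')) ∧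
    (g'.codiff₂ o' (extD φ') = 0 ↔ g.codiff₂ o (extD φ) = 0) ∧
    -- the codifferential intertwines the pull-backs of weight `-2` and `-4`
    weightedPullback ψ Ξ (-4) (g'.codiff₁ o' φ') =
      g.codiff₁ o (weightedPullback ψ Ξ (-2) φ') := by
  subst hφ hΥ
  have hdd := hψ.pullback_codiff₂_extD o o' hφ'
  -- The weights are real exponents, while the conformal formulas use natural powers.
  have hpow2 : ∀ x, Ξ x ^ (-(-2 : ℝ)) = Ξ x ^ 2 := fun x => by
    rw [neg_neg]; exact_mod_cast Real.rpow_natCast (Ξ x) 2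
  have hpow4 : ∀ x, Ξ x ^ (-(-4 : ℝ)) = Ξ x ^ 4 := fun x => by
    rw [neg_neg]; exact_mod_cast Real.rpow_natCast (Ξ x) 4
  refine ⟨hψ.pullback_codiff₁ o o' hφ', hdd, hψ.pullback_box o o' hφ', ?_, ⟨fun h => ?_, fun h => ?_⟩,
    ?_⟩
  · have h0 : weightedPullback ψ Ξ 0 φ' = pullback ψ φ' := by
      funext x
      rw [weightedPullback, neg_zero, Real.rpow_zero, one_smul]
    funext x
    rw [h0, weightedPullback, hpow2, hdd, smul_inv_smul₀ (pow_ne_zero 2 (hψ.pos x).ne')]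
  · funext x
    have hx := hdd x
    rw [h] at hx
    have hx' : (Ξ x ^ 2)⁻¹ • g.codiff₂ o (extD (pullback ψ φ')) x = 0 := hx.symm
    exact (smul_eq_zero.1 hx').resolve_left (inv_ne_zero (pow_ne_zero 2 (hψ.pos x).ne'))
  -- This direction uses that `ψ` is onto with invertible differential, so a form with vanishing
  -- pull-back vanishes.
  · refine eq_zero_of_pullback_eq_zero ψ (funext fun x => ?_)
    rw [hdd, h]
    exact smul_zero _
  · have h2 : weightedPullback ψ Ξ (-2) φ' = fun x => Ξ x ^ 2 • pullback ψ φ' x := by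
      funext x
      rw [weightedPullback, hpow2]
    funext x
    rw [h2, weightedPullback, hpow4, hψ.pullback_codiff₁_eq o o' hφ',
      smul_inv_smul₀ (pow_ne_zero 4 (hψ.pos x).ne')]
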